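/- Let $d,m\in\mathbb N=\{1,2,\dots\}$, let $S<T$ be real numbers, let $(\Omega,\mathcal F,\mathbb P)$ be a probability space, let $W\colon[S,T]\times\Omega\to\mathbb R^m$ be a stochastic process such that $(W_{S+r}-W_S)_{r\in[0,T-S]}$ is a standard Brownian motion with continuous sample paths, let $\mathbb F_S\subseteq\mathcal F$ be a sigma-algebra which is independent of $\sigma(W_r-W_S\colon r\in[S,T])$, and let $\mathcal N=\{A\in\mathcal F\colon\mathbb P(A)=0\}$. Let $\lambda_{[a,b]}$ be the Lebesgue measure on $[a,b]$ and equip $\mathbb R^{d\times m}$ with the Hilbert-Schmidt inner product. Extended Skorohod integral. Let $[a,b]\subseteq[S,T]$, $a<b$, and let $\mathbb G\subseteq\mathcal F$ be a sigma-algebra which is independent of $\sigma(W_r-W_a\colon r\in[a,b])$. Put $\mathbb G_b=\sigma(\mathbb G\cup\sigma(W_r-W_a\colon r\in[a,b])\cup\mathcal N)$. Let $\mathcal S$ be the set of all $F\in L^2(\mathbb P|_{\mathbb G_b};\mathbb R^d)$ of the form $$F=f\Big(\int_a^b\phi_1(r)\,dW_r,\dots,\int_a^b\phi_n(r)\,dW_r\Big)h,\qquad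 n\in\mathbb N,\ \phi_1,\dots,\phi_n\in L^2(\lambda_{[a,b]};\mathbb R^m),\ h\in\mathbb R^d,$$ where $f\colon\mathbb R^n\times\Omega\to\mathbb R$ is such that every $f(\cdot,\omega)$ is smooth and bounded together with all its derivatives (with bounds that may depend on $\omega$) and every $f(x,\cdot)$ is $\sigma(\mathbb G\cup\mathcal N)$-measurable, and for which $$DF=\sum_{i=1}^n\frac{\partial f}{\partial x_i}\Big(\int_a^b\phi_1(r)\,dW_r,\dots,\int_a^b\phi_n(r)\,dW_r\Big)\,h\,\phi_i^*$$ is in $L^2(\mathbb P;L^2(\lambda_{[a,b]};\mathbb R^{d\times m}))$; extend $D$ linearly to $\operatorname{span}(\mathcal S)$. A random variable $X\colon\Omega\to L^2(\lambda_{[a,b]};\mathbb R^{d\times m})$ is called $(\mathbb P,\mathbb G,W|_{[a,b]\times\Omega};\mathbb R^d)$-Skorohod integrable if $X\in L^2(\mathbb P|_{\mathbb G_b};L^2(\lambda_{[a,b]};\mathbb R^{d\times m}))$ and there is a $c\in[0,\infty)$ such that $\mathbb E[\langle DF,X\rangle_{L^2(\lambda_{[a,b]};\mathbb R^{d\times m})}]\le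 c\,\|F\|_{L^2(\mathbb P;\mathbb R^d)}$ for all $F\in\operatorname{span}(\mathcal S)$. In that case $\int_a^bX_r\,\delta W_r^{\mathbb G}$ denotes the unique element of $L^2(\mathbb P|_{\mathbb G_b};\mathbb R^d)$ with $$\mathbb E\Big[\Big\langle F,\int_a^bX_r\,\delta W_r^{\mathbb G}\Big\rangle_{\mathbb R^d}\Big]=\mathbb E\big[\langle DF,X\rangle_{L^2(\lambda_{[a,b]};\mathbb R^{d\times m})}\big]\qquad\text{for all }F\in\mathcal S.$$ Proposition. Let $X\in L^0(\mathbb P;L^2(\lambda_{[S,T]};\mathbb R^{d\times m}))$, let $s,t\in[S,T]$ satisfy $s<t$, and let $$\mathbb F_{[S,s]\cup[t,T]}=\sigma\big(\mathbb F_S\cup\sigma(W_r-W_S\colon r\in[S,s])\cup\sigma(W_r-W_t\colon r\in[t,T])\cup\mathcal N\big).$$ Then the following two statements are equivalent: (i) $X|_{[s,t]\times\Omega}$ is $(\mathbb P,\mathbb F_{[S,s]\cup[t,T]},W|_{[s,t]\times\Omega};\mathbb R^d)$-Skorohod integrable; (ii) $\mathbf 1_{[s,t]}X$ is $(\mathbb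 P,\mathbb F_S,W;\mathbb R^d)$-Skorohod integrable. If either of them holds, then both integrals exist and, $\mathbb P$-almost surely, $$\int_s^tX_r\,\delta W_r^{\mathbb F_{[S,s]\cup[t,T]}}=\int_S^T\mathbf 1_{[s,t]}(r)X_r\,\delta W_r^{\mathbb F_S}.$$ -/

import Mathlib

open MeasureTheory ProbabilityTheory Set

namespace ExtendedSkorohod

/-- Lebesgue measure on the interval `[a, b]`. -/
noncomputable abbrev leb (a b : ℝ) : Measure ℝ := volume.restrict (Icc a b)

/-- `ℝ^d` with the Euclidean norm. -/
abbrev Vec (d : ℕ) : Type := EuclideanSpace ℝ (Fin d)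

/-- `ℝ^{d × m}` with the Hilbert-Schmidt (Frobenius) norm and inner product. -/
abbrev Mat (d m : ℕ) : Type := EuclideanSpace ℝ (Fin d × Fin m)

/-- The Hilbert space `L²(λ_[a,b]; ℝ^{d × m})`. -/
abbrev PathSpace (d m : ℕ) (a b : ℝ) : Type := Lp (Mat d m) 2 (leb a b)

/-- `h φ`, that is the matrix `h φ^*` with entries `h_k φ_j`. -/
noncomputable def outer {d m : ℕ} (h : Vec d) (v : Vec m) : Mat d m :=
  WithLp.toLp 2 (fun kj => h kj.1 * v kj.2)

/-- `(W_{a+t} - W_a)_{t ∈ [0, b-a]}` is an `m`-dimensional standard Brownian motion with continuous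
sample paths. Only the values of `W` at times in `[a, b]` matter. -/
structure IsBrownianOn {Ω : Type*} [mΩ : MeasurableSpace Ω] {m : ℕ} (P : Measure Ω)
    (W : ℝ → Ω → Vec m) (a b : ℝ) : Prop where
  measurable : ∀ t ∈ Icc a b, Measurable (W t)
  continuous : ∀ ω, ContinuousOn (fun t => W t ω) (Icc a b)
  indep_increments : HasIndepIncrements (fun t : Icc a b => W t) P
  law_increments : ∀ s ∈ Icc a b, ∀ t ∈ Icc a b, s ≤ t →
    HasLaw (fun ω => W t ω - W s ω)
      (multivariateGaussian (0 : Vec m) ((t - s) • (1 : Matrix (Fin m) (Fin m) ℝ))) P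

/-- The sigma-algebra generated by the `P`-null events. -/
abbrev nullSigma {Ω : Type*} [mΩ : MeasurableSpace Ω] (P : Measure Ω) : MeasurableSpace Ω :=
  MeasurableSpace.generateFrom {A | MeasurableSet A ∧ P A = 0}

/-- The sigma-algebra generated by `W_r - W_a`, `r ∈ [a, b]`. -/
abbrev incrSigma {Ω : Type*} {m : ℕ} (W : ℝ → Ω → Vec m) (a b : ℝ) : MeasurableSpace Ω :=
  ⨆ r ∈ Icc a b, MeasurableSpace.comap (fun ω => W r ω - W a ω) inferInstance

/-- The sigma-algebra generated by `𝔽`, by `W_r - W_a` for `r ∈ [a, b]`, and by the null events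
(for `a = S`, `b = T` this is `𝔽_T`). -/
abbrev fullSigma {Ω : Type*} {m : ℕ} (𝔽 : MeasurableSpace Ω) [mΩ : MeasurableSpace Ω]
    (P : Measure Ω) (W : ℝ → Ω → Vec m) (a b : ℝ) : MeasurableSpace Ω :=
  𝔽 ⊔ incrSigma W a b ⊔ nullSigma P

/-- The sigma-algebra `𝔽_{[S,s] ∪ [t,T]}`, generated by `𝔽`, by `W_r - W_S` for `r ∈ [S, s]`,
by `W_r - W_t` for `r ∈ [t, T]`, and by the null events. -/
abbrev outerSigma {Ω : Type*} {m : ℕ} (𝔽 : MeasurableSpace Ω) [mΩ : MeasurableSpace Ω]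
    (P : Measure Ω) (W : ℝ → Ω → Vec m) (S s t T : ℝ) : MeasurableSpace Ω :=
  𝔽 ⊔ incrSigma W S s ⊔ incrSigma W t T ⊔ nullSigma P

/-- The graph of the Wiener integral `L²(λ_[a,b]; ℝ^m) → L²(P)`, `φ ↦ ∫_a^b φ(r) dW_r`: the
closure of the linear span of the pairs `(1_{(u,v]} e_j, W_v^j - W_u^j)` with `a ≤ u ≤ v ≤ b`. -/
noncomputable def wienerGraph {Ω : Type*} [mΩ : MeasurableSpace Ω] {m : ℕ} (P : Measure Ω)
    (W : ℝ → Ω → Vec m) (a b : ℝ) : Submodule ℝ (Lp (Vec m) 2 (leb a b) × Lp ℝ 2 P) :=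
  (Submodule.span ℝ {p : Lp (Vec m) 2 (leb a b) × Lp ℝ 2 P |
    ∃ u v : ℝ, a ≤ u ∧ u ≤ v ∧ v ≤ b ∧ ∃ j : Fin m,
      (p.1 =ᵐ[leb a b] (Ioc u v).indicator (fun _ => EuclideanSpace.single j (1 : ℝ))) ∧
      (p.2 =ᵐ[P] fun ω => W v ω j - W u ω j)}).topologicalClosure

/-- `I = ∫_a^b φ(r) dW_r` in `L²(P)`. -/
def IsWienerIntegral {Ω : Type*} [mΩ : MeasurableSpace Ω] {m : ℕ} (P : Measure Ω)
    (W : ℝ → Ω → Vec m) (a b : ℝ) (φ : Lp (Vec m) 2 (leb a b)) (I : Lp ℝ 2 P) : Prop :=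
  (φ, I) ∈ wienerGraph P W a b

/-- `f ∈ C_b^{∞,𝒢}(ℝ^n × Ω, ℝ)`: every `f(·, ω)` is smooth and bounded with all its derivatives
(with bounds that may depend on `ω`), and every `f(x, ·)` is `𝒢`-measurable. -/
structure IsSmoothField {Ω : Type*} (𝒢 : MeasurableSpace Ω) {n : ℕ}
    (f : (Fin n → ℝ) → Ω → ℝ) : Prop where
  smooth : ∀ ω, ContDiff ℝ ((⊤ : ℕ∞) : WithTop ℕ∞) (fun x => f x ω)
  bounded : ∀ ω, ∀ k : ℕ, ∃ C : ℝ, ∀ x, ‖iteratedFDeriv ℝ k (fun y => f y ω) x‖ ≤ C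
  measurable : ∀ x, Measurable[𝒢] (f x)

/-- The pairs `(F, DF)` where `F = f(∫ φ_1 dW, …, ∫ φ_n dW) h` is an elementary random variable
and `DF = ∑_i ∂_i f(∫ φ_1 dW, …, ∫ φ_n dW) φ_i h` is its extended Malliavin derivative, both of
them being square integrable. -/
noncomputable def malliavinElementary {Ω : Type*} {m : ℕ} (d : ℕ) (𝔽 : MeasurableSpace Ω)
    [mΩ : MeasurableSpace Ω] (P : Measure Ω) (W : ℝ → Ω → Vec m) (a b : ℝ) :
    Set (Lp (Vec d) 2 P × Lp (PathSpace d m a b) 2 P) :=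
  {p | ∃ n : ℕ, 1 ≤ n ∧
    ∃ φ : Fin n → Lp (Vec m) 2 (leb a b), ∃ I : Fin n → Lp ℝ 2 P,
      (∀ i, IsWienerIntegral P W a b (φ i) (I i)) ∧
    ∃ f : (Fin n → ℝ) → Ω → ℝ, IsSmoothField (𝔽 ⊔ nullSigma P) f ∧
    ∃ h : Vec d,
      (∀ᵐ ω ∂P, p.1 ω = f (fun i => I i ω) ω • h) ∧
      (∀ᵐ ω ∂P, ∀ᵐ r ∂(leb a b), p.2 ω r =
        ∑ i, fderiv ℝ (fun x => f x ω) (fun j => I j ω) (Pi.single i 1) • outer h (φ i r))}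

/-- The graph of the extended Malliavin derivative on the linear span of the elementary random
variables. -/
noncomputable def malliavinGraph {Ω : Type*} {m : ℕ} (d : ℕ) (𝔽 : MeasurableSpace Ω)
    [mΩ : MeasurableSpace Ω] (P : Measure Ω) (W : ℝ → Ω → Vec m) (a b : ℝ) :
    Submodule ℝ (Lp (Vec d) 2 P × Lp (PathSpace d m a b) 2 P) :=
  Submodule.span ℝ (malliavinElementary d 𝔽 P W a b)

/-- `X` is `(P, 𝔽, W; ℝ^d)`-Skorohod integrable on `[a, b]`: `X` belongs to
`L²(P|_{𝔽_b}; L²(λ_[a,b]; ℝ^{d × m}))`, where `𝔽_b` is `fullSigma 𝔽 P W a b`, and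
`F ↦ E⟨DF, X⟩` is bounded in the norm of `L²(P; ℝ^d)` on the span of the elementary random
variables. -/
def IsSkorohodIntegrable {Ω : Type*} {d m : ℕ} (𝔽 : MeasurableSpace Ω)
    [mΩ : MeasurableSpace Ω] (P : Measure Ω) (W : ℝ → Ω → Vec m) (a b : ℝ)
    (X : Ω → PathSpace d m a b) : Prop :=
  AEStronglyMeasurable[fullSigma 𝔽 P W a b] X P ∧ MemLp X 2 P ∧
    ∃ c : ℝ, 0 ≤ c ∧ ∀ p ∈ malliavinGraph d 𝔽 P W a b,
      ∫ ω, inner ℝ (p.2 ω) (X ω) ∂P ≤ c * ‖p.1‖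

/-- `Y ∈ L²(P|_{𝔽_b}; ℝ^d)` is the extended Skorohod integral `∫_a^b X_r δW_r^𝔽` of the
Skorohod integrable `X`. -/
def IsSkorohodIntegral {Ω : Type*} {d m : ℕ} (𝔽 : MeasurableSpace Ω)
    [mΩ : MeasurableSpace Ω] (P : Measure Ω) (W : ℝ → Ω → Vec m) (a b : ℝ)
    (X : Ω → PathSpace d m a b) (Y : Lp (Vec d) 2 P) : Prop :=
  IsSkorohodIntegrable 𝔽 P W a b X ∧
  AEStronglyMeasurable[fullSigma 𝔽 P W a b] Y P ∧
    ∀ p ∈ malliavinElementary d 𝔽 P W a b,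
      ∫ ω, inner ℝ (p.1 ω) (Y ω) ∂P = ∫ ω, inner ℝ (p.2 ω) (X ω) ∂P

/-- The restriction `x|_{[s,t]}` of (a class of) a function `x` on `[S, T]`. -/
noncomputable def restrictTime {d m : ℕ} {S T s t : ℝ} (hs : S ≤ s) (ht : t ≤ T)
    (x : PathSpace d m S T) : PathSpace d m s t :=
  ((Lp.memLp x).mono_measure
    (Measure.restrict_mono (Icc_subset_Icc hs ht) le_rfl) : MemLp x 2 (leb s t)).toLp x

/-- The product `1_{[s,t]} x` for (a class of) a function `x` on `[S, T]`. -/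
noncomputable def indicatorTime {d m : ℕ} {S T : ℝ} (s t : ℝ)
    (x : PathSpace d m S T) : PathSpace d m S T :=
  ((Lp.memLp x).indicator measurableSet_Icc).toLp ((Icc s t).indicator x)

end ExtendedSkorohod

namespace ExtendedSkorohod

/-! ### Trigonometric functions as a determining class -/

section Core

variable {Ω Ω' K : Type*} {mΩ : MeasurableSpace Ω} {mΩ' : MeasurableSpace Ω'}

/-! Both Skorohod integrals are characterised by the duality E⟨F, Y⟩ = E⟨DF, X⟩, and both are sought
in the same L² space, since the two full sigma-algebras coincide (`fullSigma_outerSigma`). It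
therefore suffices to show that a given Y satisfies the duality over [s,t] if and only if it
satisfies it over [S,T] (`IsBrownianOn.isSkorohodIntegral_restrict_iff`). Integrability follows
because it is equivalent to the existence of such a Y: one direction is Hahn-Banach and Riesz, the
other Cauchy-Schwarz.

From [s,t] to [S,T]: a Wiener integral over [S,T] is one over [s,t] plus a variable J depending only
on the increments outside (s,t) (`IsBrownianOn.exists_wiener_split`). Replacing f(x, ω) by f(x +
J(ω), ω) makes each elementary variable over [S,T] an elementary variable over [s,t] for the larger
sigma-algebra, and its new derivative is the old one restricted to [s,t]
(`restrict_mem_malliavinElementary`). Extension by zero being adjoint to restriction, the pairings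
agree.

From [S,T] to [s,t]: now f may depend on the outer increments in an arbitrary measurable way, so the
test variables over [S,T] have to be rich enough. Truncating to events where f and its first partial
derivatives are bounded and then mollifying in x (`integral_field_eq_of_test`) reduces to F = Z ψ(I)
h with Z bounded and ψ a test function. By uniqueness of characteristic functions
(`setIntegral_eq_zero_of_trig`) it is enough to take Z = 1_A cos L or 1_A sin L, with A in 𝔽 ∨ 𝒩 and
L a linear combination of outer increments. Such an F is elementary over [S,T], and the extra part
of DF, which comes from differentiating in L, vanishes almost everywhere on [s,t] and so is
orthogonal to 1_{[s,t]} X (`setIntegral_mul_trig_eq_zero`).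

The same trigonometric variables, with L ranging over the increments on all of [S,T], show that Y is
unique (`IsBrownianOn.eq_of_forall_elementary`). -/

lemma map_pi_finset_eq_of_trig {K : Type*} {μ ν : Measure Ω} [IsFiniteMeasure μ]
    [IsFiniteMeasure ν] {J : K → Ω → ℝ} (hJ : ∀ k, Measurable (J k))
    (hcos : ∀ L ∈ Submodule.span ℝ (range J), ∫ ω, Real.cos (L ω) ∂μ = ∫ ω, Real.cos (L ω) ∂ν)
    (hsin : ∀ L ∈ Submodule.span ℝ (range J), ∫ ω, Real.sin (L ω) ∂μ = ∫ ω, Real.sin (L ω) ∂ν)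
    (I : Finset K) :
    μ.map (fun ω (k : I) => J k ω) = ν.map (fun ω (k : I) => J k ω) := by
  have hJI : Measurable fun ω (k : I) => J k ω := measurable_pi_lambda _ fun k => hJ k
  set Φ : Ω → EuclideanSpace ℝ I := fun ω => WithLp.toLp 2 (fun k : I => J k ω) with hΦ
  have hΦm : Measurable Φ := (WithLp.measurable_toLp 2 _).comp hJI
  -- The characteristic function of the vector at u is ∫ cos L + i ∫ sin L with L = ∑ u_k J_k.
  have key : μ.map Φ = ν.map Φ := by
    refine Measure.ext_of_charFun (funext fun u => ?_)
    set L : Ω → ℝ := ∑ k : I, u k • J k with hL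
    have hLmem : L ∈ Submodule.span ℝ (range J) :=
      Submodule.sum_mem _ fun k _ => Submodule.smul_mem _ _ (Submodule.subset_span ⟨k, rfl⟩)
    have hLm : Measurable L := by
      have : L = fun ω => ∑ k : I, u k * J k ω := by ext ω; simp [hL]
      rw [this]
      exact Finset.measurable_sum _ fun k _ => (hJ k).const_mul _
    have hin : ∀ ω, inner ℝ (Φ ω) u = L ω := by
      intro ω
      simp [hΦ, hL, PiLp.inner_apply]
    have hexp : ∀ (ρ : Measure Ω) [IsFiniteMeasure ρ], charFun (ρ.map Φ) u
        = ((∫ ω, Real.cos (L ω) ∂ρ : ℝ) : ℂ) + ((∫ ω, Real.sin (L ω) ∂ρ : ℝ) : ℂ) * Complex.I := by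
      intro ρ _
      rw [charFun_apply, integral_map hΦm.aemeasurable (by fun_prop)]
      simp_rw [hin, Complex.exp_mul_I]
      have hc : Integrable (fun ω => Real.cos (L ω)) ρ :=
        Integrable.of_bound (Real.measurable_cos.comp hLm).aestronglyMeasurable 1
          (.of_forall fun ω => by simpa using Real.abs_cos_le_one _)
      have hs : Integrable (fun ω => Real.sin (L ω)) ρ :=
        Integrable.of_bound (Real.measurable_sin.comp hLm).aestronglyMeasurable 1
          (.of_forall fun ω => by simpa using Real.abs_sin_le_one _)
      rw [← integral_complex_ofReal, ← integral_complex_ofReal, ← integral_mul_const,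
        ← integral_add hc.ofReal (hs.ofReal.mul_const _)]
      simp
    rw [hexp μ, hexp ν, hcos L hLmem, hsin L hLmem]
  have := congrArg (Measure.map (WithLp.ofLp : EuclideanSpace ℝ I → (I → ℝ))) key
  rwa [Measure.map_map (WithLp.measurable_ofLp 2 _) hΦm,
    Measure.map_map (WithLp.measurable_ofLp 2 _) hΦm] at this

lemma map_pi_eq_of_trig {μ ν : Measure Ω} [IsFiniteMeasure μ]
    [IsFiniteMeasure ν] {J : K → Ω → ℝ} (hJ : ∀ k, Measurable (J k))
    (hcos : ∀ L ∈ Submodule.span ℝ (range J), ∫ ω, Real.cos (L ω) ∂μ = ∫ ω, Real.cos (L ω) ∂ν)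
    (hsin : ∀ L ∈ Submodule.span ℝ (range J), ∫ ω, Real.sin (L ω) ∂μ = ∫ ω, Real.sin (L ω) ∂ν) :
    μ.map (fun ω k => J k ω) = ν.map (fun ω k => J k ω) := by
  have hJ' : Measurable fun ω k => J k ω := measurable_pi_lambda _ hJ
  refine IsProjectiveLimit.unique (P := fun I => μ.map (fun ω (k : I) => J k ω))
    (fun I => ?_) (fun I => ?_)
  · rw [Measure.map_map (Finset.measurable_restrict I) hJ']
    rfl
  · rw [Measure.map_map (Finset.measurable_restrict I) hJ']
    exact (map_pi_finset_eq_of_trig hJ hcos hsin I).symm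

/-- Restricting both measures to the event {g ∈ A} turns equality of the laws of J into equality of
the joint laws of (g, J) on rectangles. Every set of the generated sigma-algebra is a preimage under
(g, J). -/
lemma measure_eq_of_trig {μ ν : Measure Ω} [IsFiniteMeasure μ] [IsFiniteMeasure ν]
    {g : Ω → Ω'} (hg : Measurable g) {J : K → Ω → ℝ} (hJ : ∀ k, Measurable (J k))
    (hcos : ∀ A, MeasurableSet A → ∀ L ∈ Submodule.span ℝ (range J),
      ∫ ω in g ⁻¹' A, Real.cos (L ω) ∂μ = ∫ ω in g ⁻¹' A, Real.cos (L ω) ∂ν)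
    (hsin : ∀ A, MeasurableSet A → ∀ L ∈ Submodule.span ℝ (range J),
      ∫ ω in g ⁻¹' A, Real.sin (L ω) ∂μ = ∫ ω in g ⁻¹' A, Real.sin (L ω) ∂ν)
    {B : Set Ω} (hB : MeasurableSet[mΩ'.comap g ⊔ ⨆ k, (inferInstance : MeasurableSpace ℝ).comap
      (J k)] B) : μ B = ν B := by
  have hJ' : Measurable fun ω k => J k ω := measurable_pi_lambda _ hJ
  have hprod : μ.map (fun ω => (g ω, fun k => J k ω)) = ν.map (fun ω => (g ω, fun k => J k ω)) := by
    refine Measure.ext_prod fun {A C} hA hC => ?_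
    have h := congrArg (fun ρ => ρ C)
      (map_pi_eq_of_trig (μ := μ.restrict (g ⁻¹' A)) (ν := ν.restrict (g ⁻¹' A)) hJ
        (hcos A hA) (hsin A hA))
    simp only [Measure.map_apply hJ' hC, Measure.restrict_apply (hJ' hC)] at h
    rw [Measure.map_apply (hg.prodMk hJ') (hA.prod hC), Measure.map_apply (hg.prodMk hJ') (hA.prod hC),
      mk_preimage_prod, inter_comm, h]
  have hle : mΩ'.comap g ⊔ ⨆ k, (inferInstance : MeasurableSpace ℝ).comap (J k) ≤
      MeasurableSpace.comap (fun ω => (g ω, fun k => J k ω)) inferInstance := by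
    refine sup_le ?_ (iSup_le fun k => ?_)
    · rw [MeasurableSpace.comap_le_iff_le_map]
      exact fun A hA => ⟨Prod.fst ⁻¹' A, measurable_fst hA, rfl⟩
    · rw [MeasurableSpace.comap_le_iff_le_map]
      exact fun A hA => ⟨(fun p : Ω' × (K → ℝ) => p.2 k) ⁻¹' A,
        ((measurable_pi_apply k).comp measurable_snd) hA, rfl⟩
  obtain ⟨C, hC, rfl⟩ := hle _ hB
  rw [← Measure.map_apply (hg.prodMk hJ') hC, hprod, Measure.map_apply (hg.prodMk hJ') hC]

lemma setIntegral_withDensity_ofReal {P : Measure Ω} {G : Ω → ℝ} (hG : Integrable G P)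
    {A : Set Ω} (hA : MeasurableSet A) (φ : Ω → ℝ) :
    ∫ ω in A, φ ω ∂(P.withDensity fun ω => ENNReal.ofReal (G ω)) =
      ∫ ω in A, (max (G ω) 0) * φ ω ∂P := by
  rw [setIntegral_withDensity_eq_setIntegral_toReal_smul₀ (hG.1.aemeasurable.ennreal_ofReal.restrict)
    (.of_forall fun _ => ENNReal.ofReal_lt_top) _ hA]
  simp [ENNReal.toReal_ofReal']

/-- If the integrals of `G` against the trigonometric functions of the finite linear combinations
of the `J k` vanish on all sets in `𝒢`, then the integral of `G` vanishes on all sets in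
`σ(𝒢, J)`. -/
theorem setIntegral_eq_zero_of_trig {Ω K : Type*} (𝒢 : MeasurableSpace Ω)
    {mΩ : MeasurableSpace Ω} (h𝒢 : 𝒢 ≤ mΩ) {P : Measure Ω}
    {G : Ω → ℝ} (hG : Integrable G P) {J : K → Ω → ℝ} (hJ : ∀ k, Measurable (J k))
    (hcos : ∀ A, MeasurableSet[𝒢] A → ∀ L ∈ Submodule.span ℝ (range J),
      ∫ ω in A, Real.cos (L ω) * G ω ∂P = 0)
    (hsin : ∀ A, MeasurableSet[𝒢] A → ∀ L ∈ Submodule.span ℝ (range J),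
      ∫ ω in A, Real.sin (L ω) * G ω ∂P = 0)
    {B : Set Ω} (hB : MeasurableSet[𝒢 ⊔ ⨆ k, (inferInstance : MeasurableSpace ℝ).comap
      (J k)] B) : ∫ ω in B, G ω ∂P = 0 := by
  have hBm : MeasurableSet[mΩ] B :=
    (sup_le h𝒢 (iSup_le fun k => (hJ k).comap_le) : _ ≤ mΩ) _ hB
  have hLm : ∀ L ∈ Submodule.span ℝ (range J), Measurable L := by
    intro L hL
    induction hL using Submodule.span_induction with
    | mem x hx => obtain ⟨k, rfl⟩ := hx; exact hJ k
    | zero => exact measurable_const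
    | add x y _ _ hx hy => exact hx.add hy
    | smul a x _ hx => exact hx.const_smul a
  -- The signed density G is split into its positive and negative parts, so that the claim becomes
  -- equality of two finite measures at B.
  set μ := P.withDensity fun ω => ENNReal.ofReal (G ω)
  set ν := P.withDensity fun ω => ENNReal.ofReal (-G ω)
  have hμ : IsFiniteMeasure μ := isFiniteMeasure_withDensity_ofReal hG.2
  have hν : IsFiniteMeasure ν := isFiniteMeasure_withDensity_ofReal hG.neg.2
  have key : ∀ (φ : Ω → ℝ), Measurable φ → (∀ ω, |φ ω| ≤ 1) → ∀ A, MeasurableSet A →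
      ∫ ω in A, φ ω * G ω ∂P = (∫ ω in A, φ ω ∂μ) - ∫ ω in A, φ ω ∂ν := by
    intro φ hφ hφ1 A hA
    rw [setIntegral_withDensity_ofReal hG hA, setIntegral_withDensity_ofReal (G := fun ω => -G ω) hG.neg hA,
      ← integral_sub]
    · refine integral_congr_ae (.of_forall fun ω => ?_)
      dsimp only
      rcases le_total (G ω) 0 with h | h
      · rw [max_eq_right h, max_eq_left (by linarith)]; ring
      · rw [max_eq_left h, max_eq_right (by linarith)]; ring
    · exact (hG.pos_part.integrableOn).mul_bdd (c := 1) hφ.aestronglyMeasurable (.of_forall hφ1)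
    · exact (hG.neg.pos_part.integrableOn).mul_bdd (c := 1) hφ.aestronglyMeasurable (.of_forall hφ1)
  have hm : μ B = ν B := by
    refine measure_eq_of_trig (mΩ' := 𝒢) (g := id) (measurable_id'' h𝒢) hJ ?_ ?_
      (B := B) (by rwa [MeasurableSpace.comap_id])
    · intro A hA L hL
      have := key _ (Real.measurable_cos.comp (hLm L hL)) (fun ω => Real.abs_cos_le_one _) A
        (h𝒢 _ hA)
      simp only [Function.comp_apply] at this
      rw [hcos A hA L hL] at this
      exact (sub_eq_zero.1 this.symm)
    · intro A hA L hL
      have := key _ (Real.measurable_sin.comp (hLm L hL)) (fun ω => Real.abs_sin_le_one _) A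
        (h𝒢 _ hA)
      simp only [Function.comp_apply] at this
      rw [hsin A hA L hL] at this
      exact (sub_eq_zero.1 this.symm)
  have := key (fun _ => 1) measurable_const (by simp) B hBm
  simpa [measureReal_def, hm] using this

/-- A function whose integrals vanish on a sub-sigma-algebra is orthogonal to all the bounded
functions that are measurable with respect to it. -/
theorem integral_mul_eq_zero_of_forall_setIntegral {Ω : Type*} (𝒢 : MeasurableSpace Ω)
    {mΩ : MeasurableSpace Ω} (h𝒢 : 𝒢 ≤ mΩ)
    {P : Measure Ω} [IsFiniteMeasure P] {G : Ω → ℝ} (hG : Integrable G P)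
    (h0 : ∀ B, MeasurableSet[𝒢] B → ∫ ω in B, G ω ∂P = 0) {Z : Ω → ℝ} (hZ : Measurable[𝒢] Z)
    {C : ℝ} (hC : ∀ ω, |Z ω| ≤ C) : ∫ ω, Z ω * G ω ∂P = 0 := by
  -- The hypothesis says that the conditional expectation of G vanishes; Z is then pulled out of it.
  have hcond : (0 : Ω → ℝ) =ᵐ[P] P[G|𝒢] := by
    refine ae_eq_condExp_of_forall_setIntegral_eq h𝒢 hG (fun s _ _ => ?_) ?_ ?_
    · exact (integrable_zero Ω ℝ P).integrableOn
    · intro s hs _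
      rw [h0 s hs]; simp
    · exact stronglyMeasurable_zero.aestronglyMeasurable
  have hpull := condExp_mul_of_stronglyMeasurable_left (μ := P) hZ.stronglyMeasurable
    (hG.bdd_mul (c := C) (hZ.mono h𝒢 le_rfl).aestronglyMeasurable (.of_forall hC)) hG
  calc ∫ ω, Z ω * G ω ∂P = ∫ ω, (P[fun ω => Z ω * G ω|𝒢]) ω ∂P := (integral_condExp h𝒢).symm
    _ = ∫ ω, (0 : ℝ) ∂P := by
      refine integral_congr_ae ?_
      filter_upwards [hpull, hcond] with ω h1 h2
      have : (P[fun ω => Z ω * G ω|𝒢]) ω = (Z * P[G|𝒢]) ω := h1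
      rw [this, Pi.mul_apply, ← h2]; simp
    _ = 0 := by simp

end Core

/-! ### Restriction and extension by zero of paths -/

section Paths

variable {E : Type*} [NormedAddCommGroup E] {S T s t : ℝ}

lemma leb_mono (hs : S ≤ s) (ht : t ≤ T) : leb s t ≤ leb S T :=
  Measure.restrict_mono (Icc_subset_Icc hs ht) le_rfl

lemma leb_restrict (hs : S ≤ s) (ht : t ≤ T) : (leb S T).restrict (Icc s t) = leb s t := by
  rw [Measure.restrict_restrict measurableSet_Icc,
    inter_eq_left.2 (Icc_subset_Icc hs ht)]

lemma memLp_indicator_leb (hs : S ≤ s) (ht : t ≤ T) {f : ℝ → E} (hf : MemLp f 2 (leb s t)) :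
    MemLp ((Icc s t).indicator f) 2 (leb S T) := by
  rw [memLp_indicator_iff_restrict measurableSet_Icc, leb_restrict hs ht]
  exact hf

lemma indicator_ae_leb (hs : S ≤ s) (ht : t ≤ T) {f g : ℝ → E} (h : f =ᵐ[leb s t] g) :
    (Icc s t).indicator f =ᵐ[leb S T] (Icc s t).indicator g := by
  rw [← leb_restrict hs ht] at h
  filter_upwards [(ae_restrict_iff' measurableSet_Icc).1 h] with r hr
  by_cases hm : r ∈ Icc s t
  · simp [hm, hr hm]
  · simp [hm]

variable [NormedSpace ℝ E]

/-- Restriction of functions on `[S, T]` to `[s, t]` as a continuous linear map. -/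
noncomputable def restrictL (E : Type*) [NormedAddCommGroup E] [NormedSpace ℝ E]
    (hs : S ≤ s) (ht : t ≤ T) : Lp E 2 (leb S T) →L[ℝ] Lp E 2 (leb s t) :=
  LinearMap.mkContinuous
    { toFun := fun x => ((Lp.memLp x).mono_measure (leb_mono hs ht)).toLp x
      map_add' := fun x y => by
        rw [← MemLp.toLp_add]
        exact MemLp.toLp_congr _ _ (ae_mono (leb_mono hs ht) (Lp.coeFn_add x y))
      map_smul' := fun c x => by
        rw [RingHom.id_apply, ← MemLp.toLp_const_smul]
        exact MemLp.toLp_congr _ _ (ae_mono (leb_mono hs ht) (Lp.coeFn_smul c x)) }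
    1 (fun x => by
      simp only [LinearMap.coe_mk, AddHom.coe_mk, one_mul]
      rw [Lp.norm_toLp, Lp.norm_def]
      exact ENNReal.toReal_mono (Lp.eLpNorm_ne_top x) (eLpNorm_mono_measure _ (leb_mono hs ht)))

lemma restrictL_coe (hs : S ≤ s) (ht : t ≤ T) (x : Lp E 2 (leb S T)) :
    restrictL E hs ht x =ᵐ[leb s t] x :=
  MemLp.coeFn_toLp ((Lp.memLp x).mono_measure (leb_mono hs ht))

/-- Extension by zero of functions on `[s, t]` to `[S, T]` as a continuous linear map. -/
noncomputable def extendL (E : Type*) [NormedAddCommGroup E] [NormedSpace ℝ E]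
    (hs : S ≤ s) (ht : t ≤ T) : Lp E 2 (leb s t) →L[ℝ] Lp E 2 (leb S T) :=
  LinearMap.mkContinuous
    { toFun := fun x => (memLp_indicator_leb hs ht (Lp.memLp x)).toLp _
      map_add' := fun x y => by
        rw [← MemLp.toLp_add]
        refine MemLp.toLp_congr _ _ ((indicator_ae_leb hs ht (Lp.coeFn_add x y)).trans ?_)
        rw [indicator_add']
      map_smul' := fun c x => by
        rw [RingHom.id_apply, ← MemLp.toLp_const_smul]
        refine MemLp.toLp_congr _ _ ((indicator_ae_leb hs ht (Lp.coeFn_smul c x)).trans ?_)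
        exact .of_eq (indicator_const_smul _ c _) }
    1 (fun x => by
      simp only [LinearMap.coe_mk, AddHom.coe_mk, one_mul]
      rw [Lp.norm_toLp, Lp.norm_def, eLpNorm_indicator_eq_eLpNorm_restrict measurableSet_Icc,
        leb_restrict hs ht])

lemma extendL_coe (hs : S ≤ s) (ht : t ≤ T) (x : Lp E 2 (leb s t)) :
    extendL E hs ht x =ᵐ[leb S T] (Icc s t).indicator x :=
  MemLp.coeFn_toLp (memLp_indicator_leb hs ht (Lp.memLp x))

lemma norm_extendL (hs : S ≤ s) (ht : t ≤ T) (x : Lp E 2 (leb s t)) :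
    ‖extendL E hs ht x‖ = ‖x‖ := by
  have : extendL E hs ht x = (memLp_indicator_leb hs ht (Lp.memLp x)).toLp _ := rfl
  rw [this, Lp.norm_toLp, Lp.norm_def, eLpNorm_indicator_eq_eLpNorm_restrict measurableSet_Icc,
        leb_restrict hs ht]

lemma restrictL_extendL (hs : S ≤ s) (ht : t ≤ T) (x : Lp E 2 (leb s t)) :
    restrictL E hs ht (extendL E hs ht x) = x := by
  refine Lp.ext ((restrictL_coe hs ht _).trans ?_)
  filter_upwards [ae_mono (leb_mono hs ht) (extendL_coe hs ht x),
    ae_restrict_mem measurableSet_Icc] with r h hr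
  rw [h, indicator_of_mem hr]

lemma extendL_restrictL {d m : ℕ} (hs : S ≤ s) (ht : t ≤ T) (x : PathSpace d m S T) :
    extendL _ hs ht (restrictL _ hs ht x) = indicatorTime s t x := by
  refine Lp.ext ((extendL_coe hs ht _).trans
    ((indicator_ae_leb hs ht (restrictL_coe hs ht x)).trans ?_))
  exact (MemLp.coeFn_toLp _).symm

lemma restrictL_indicatorTime {d m : ℕ} (hs : S ≤ s) (ht : t ≤ T) (x : PathSpace d m S T) :
    restrictL _ hs ht (indicatorTime s t x) = restrictL _ hs ht x := by
  rw [← extendL_restrictL hs ht, restrictL_extendL]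

/-- Extension by zero is the adjoint of restriction. Since 1_{[s,t]} x is the extension of the
restriction of x, this is what turns pairings over [S,T] into pairings over [s,t]. -/
lemma inner_extendL {H : Type*} [NormedAddCommGroup H] [InnerProductSpace ℝ H]
    (hs : S ≤ s) (ht : t ≤ T) (x : Lp H 2 (leb S T))
    (y : Lp H 2 (leb s t)) : inner ℝ x (extendL H hs ht y) = inner ℝ (restrictL H hs ht x) y := by
  rw [L2.inner_def, L2.inner_def]
  have h1 : ∫ r, inner ℝ (x r) (extendL H hs ht y r) ∂(leb S T) =
      ∫ r, (Icc s t).indicator (fun r => inner ℝ (x r) (y r)) r ∂(leb S T) := by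
    refine integral_congr_ae ?_
    filter_upwards [extendL_coe hs ht y] with r hr
    rw [hr]
    by_cases h : r ∈ Icc s t <;> simp [h]
  rw [h1, integral_indicator measurableSet_Icc, leb_restrict hs ht]
  refine integral_congr_ae ?_
  filter_upwards [restrictL_coe hs ht x] with r hr
  rw [hr]

/-- `v ↦ h v^*` as a continuous linear map. -/
noncomputable def outerL {d m : ℕ} (h : Vec d) : Vec m →L[ℝ] Mat d m :=
  LinearMap.toContinuousLinearMap
    { toFun := outer h
      map_add' := fun x y => by ext i; simp [outer, mul_add]
      map_smul' := fun c x => by ext i; simp [outer, mul_left_comm] }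

/-- `φ ↦ h φ^*` on square integrable functions. -/
noncomputable def outerPath {d m : ℕ} (a b : ℝ) (h : Vec d) :
    Lp (Vec m) 2 (leb a b) →L[ℝ] PathSpace d m a b :=
  (outerL h).compLpL 2 (leb a b)

lemma outerPath_coe {d m : ℕ} {a b : ℝ} (h : Vec d) (φ : Lp (Vec m) 2 (leb a b)) :
    outerPath a b h φ =ᵐ[leb a b] fun r => outer h (φ r) :=
  (outerL h).coeFn_compLpL φ

lemma restrictL_outerPath {d m : ℕ} (hs : S ≤ s) (ht : t ≤ T) (h : Vec d)
    (φ : Lp (Vec m) 2 (leb S T)) :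
    restrictL _ hs ht (outerPath S T h φ) = outerPath s t h (restrictL _ hs ht φ) := by
  refine Lp.ext ?_
  filter_upwards [restrictL_coe hs ht (outerPath S T h φ), outerPath_coe h (restrictL _ hs ht φ),
    restrictL_coe hs ht φ, ae_mono (leb_mono hs ht) (outerPath_coe h φ)] with r h1 h2 h3 h4
  rw [h1, h2, h3, h4]

lemma coe_sum_smul_outerPath {d m n : ℕ} {a b : ℝ} (h : Vec d)
    (φ : Fin n → Lp (Vec m) 2 (leb a b)) (c : Fin n → ℝ) :
    ((∑ i, c i • outerPath a b h (φ i) : PathSpace d m a b) : ℝ → Mat d m) =ᵐ[leb a b]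
      fun r => ∑ i, c i • outer h (φ i r) := by
  have h1 := Lp.coeFn_fun_finsetSum Finset.univ (fun i => c i • outerPath a b h (φ i))
  have h2 : ∀ᵐ r ∂(leb a b), ∀ i, (c i • outerPath a b h (φ i) : PathSpace d m a b) r =
      c i • outer h (φ i r) := by
    rw [ae_all_iff]
    intro i
    filter_upwards [Lp.coeFn_smul (c i) (outerPath a b h (φ i)), outerPath_coe h (φ i)]
      with r h3 h4
    rw [h3, Pi.smul_apply, h4]
  filter_upwards [h1, h2] with r h3 h4
  rw [h3]
  exact Finset.sum_congr rfl fun i _ => h4 i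

/-- Translates the pointwise formula for DF in `malliavinElementary` into an identity in the Hilbert
space of paths, to which continuous linear maps and inner products apply. -/
lemma eq_sum_smul_outerPath_iff {d m n : ℕ} {a b : ℝ} (h : Vec d)
    (φ : Fin n → Lp (Vec m) 2 (leb a b)) (c : Fin n → ℝ) (x : PathSpace d m a b) :
    (∀ᵐ r ∂(leb a b), x r = ∑ i, c i • outer h (φ i r)) ↔
      x = ∑ i, c i • outerPath a b h (φ i) := by
  constructor
  · intro hx
    refine Lp.ext ?_
    filter_upwards [hx, coe_sum_smul_outerPath h φ c] with r h1 h2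
    rw [h1, h2]
  · rintro rfl
    exact coe_sum_smul_outerPath h φ c

end Paths

/-! ### Sigma-algebras of increments -/

section Increments

variable {Ω : Type*} {m : ℕ} {W : ℝ → Ω → Vec m}

lemma measurable_incrSigma {a b r : ℝ} (hr : r ∈ Icc a b) :
    Measurable[incrSigma W a b] (fun ω => W r ω - W a ω) :=
  Measurable.mono (comap_measurable _)
    (le_iSup₂_of_le (f := fun r (_ : r ∈ Icc a b) =>
      MeasurableSpace.comap (fun ω => W r ω - W a ω) inferInstance) r hr le_rfl) le_rfl

lemma measurable_incrSigma_sub {a b r r' : ℝ} (hr : r ∈ Icc a b) (hr' : r' ∈ Icc a b) :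
    Measurable[incrSigma W a b] (fun ω => W r ω - W r' ω) := by
  have h : (fun ω => W r ω - W r' ω) = (fun ω => W r ω - W a ω) - fun ω => W r' ω - W a ω := by
    ext1 ω; simp
  rw [h]
  exact (measurable_incrSigma hr).sub (measurable_incrSigma hr')

lemma incrSigma_le {𝒢 : MeasurableSpace Ω} {a b : ℝ}
    (h : ∀ r ∈ Icc a b, Measurable[𝒢] (fun ω => W r ω - W a ω)) : incrSigma W a b ≤ 𝒢 :=
  iSup₂_le fun r hr => (h r hr).comap_le

lemma incrSigma_le_of_measurable [mΩ : MeasurableSpace Ω] {a b : ℝ}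
    (h : ∀ r ∈ Icc a b, Measurable (W r)) : incrSigma W a b ≤ mΩ :=
  incrSigma_le fun r hr => (h r hr).sub (h a (left_mem_Icc.2 (hr.1.trans hr.2)))

/-- The sigma-algebra of the increments before `s` and after `t`. -/
abbrev sideSigma (W : ℝ → Ω → Vec m) (S s t T : ℝ) : MeasurableSpace Ω :=
  incrSigma W S s ⊔ incrSigma W t T

/-- Between a time and its projection onto [s,t] lies only an increment before s or after t, or
nothing. Hence every increment over [S,T] is an increment between two projected times plus an outer
remainder. -/
lemma measurable_sub_clamp {S s t T x : ℝ} (hs : S ≤ s) (hst : s ≤ t)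
    (hx : x ∈ Icc S T) :
    Measurable[sideSigma W S s t T] (fun ω => W x ω - W (max s (min x t)) ω) := by
  rcases le_total x s with h | h
  · rw [min_eq_left (h.trans hst), max_eq_left h]
    exact (measurable_incrSigma_sub ⟨hx.1, h⟩ ⟨hs, le_rfl⟩).mono le_sup_left le_rfl
  rcases le_total x t with h' | h'
  · rw [min_eq_left h', max_eq_right h]
    simp
  · rw [min_eq_right h', max_eq_right hst]
    exact (measurable_incrSigma ⟨h', hx.2⟩).mono le_sup_right le_rfl

end Increments

/-! ### The Wiener integral: isometry and splitting -/

section Wiener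

variable {Ω : Type*} [mΩ : MeasurableSpace Ω] {m : ℕ} {P : Measure Ω}
  {W : ℝ → Ω → Vec m} {S T s t a b : ℝ}

/-! ### Covariances of Brownian increments -/

section Moments

lemma posSemidef_smul_one {c : ℝ} (hc : 0 ≤ c) :
    (c • (1 : Matrix (Fin m) (Fin m) ℝ)).PosSemidef :=
  Matrix.PosSemidef.one.smul hc

lemma IsBrownianOn.memLp_incr (hW : IsBrownianOn P W S T) {u v : ℝ} (hu : S ≤ u)
    (huv : u ≤ v) (hv : v ≤ T) (j : Fin m) :
    MemLp (fun ω => W v ω j - W u ω j) 2 P := by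
  have hlaw := hW.law_increments u ⟨hu, huv.trans hv⟩ v ⟨hu.trans huv, hv⟩ huv
  have h1 : MemLp (fun x : Vec m => x j) 2 (P.map fun ω => W v ω - W u ω) := by
    rw [hlaw.map_eq]
    exact (IsGaussian.memLp_dual _ (EuclideanSpace.proj (𝕜 := ℝ) j) 2 (by simp))
  exact h1.comp_of_map hlaw.aemeasurable

lemma IsBrownianOn.integral_incr (hW : IsBrownianOn P W S T) {u v : ℝ} (hu : S ≤ u)
    (huv : u ≤ v) (hv : v ≤ T) (j : Fin m) :
    ∫ ω, (W v ω j - W u ω j) ∂P = 0 := by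
  have hlaw := hW.law_increments u ⟨hu, huv.trans hv⟩ v ⟨hu.trans huv, hv⟩ huv
  have h := hlaw.integral_comp (f := fun x : Vec m => x j)
    (by fun_prop : AEStronglyMeasurable (fun x : Vec m => x j) _)
  have h2 : ∫ x : Vec m, x j ∂(multivariateGaussian (0 : Vec m)
      ((v - u) • (1 : Matrix (Fin m) (Fin m) ℝ))) = 0 := by
    have := ContinuousLinearMap.integral_comp_comm (EuclideanSpace.proj (𝕜 := ℝ) j)
      (IsGaussian.integrable_id (μ := multivariateGaussian (0 : Vec m)
        ((v - u) • (1 : Matrix (Fin m) (Fin m) ℝ))))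
    simpa using this
  rw [h2] at h
  simpa using h

lemma IsBrownianOn.integral_incr_mul (hW : IsBrownianOn P W S T) {u v : ℝ} (hu : S ≤ u)
    (huv : u ≤ v) (hv : v ≤ T) (j k : Fin m) :
    ∫ ω, (W v ω j - W u ω j) * (W v ω k - W u ω k) ∂P = if j = k then v - u else 0 := by
  have hlaw := hW.law_increments u ⟨hu, huv.trans hv⟩ v ⟨hu.trans huv, hv⟩ huv
  have hP : IsProbabilityMeasure P := hlaw.isProbabilityMeasure_iff.2 inferInstance
  have hcov := hlaw.covariance_fun_comp (f := fun x : Vec m => x j) (g := fun x : Vec m => x k)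
    (by fun_prop) (by fun_prop)
  rw [covariance_eval_multivariateGaussian (posSemidef_smul_one (sub_nonneg.2 huv))] at hcov
  have hj := hW.memLp_incr hu huv hv j
  have hk := hW.memLp_incr hu huv hv k
  have h3 := covariance_eq_sub hj hk
  rw [hW.integral_incr hu huv hv j, zero_mul, sub_zero] at h3
  have h4 : ∫ ω, (W v ω j - W u ω j) * (W v ω k - W u ω k) ∂P =
      cov[fun ω => W v ω j - W u ω j, fun ω => W v ω k - W u ω k; P] := h3.symm
  rw [h4]
  refine Eq.trans ?_ (hcov.trans ?_)
  · rfl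
  · simp [Matrix.one_apply]

lemma IsBrownianOn.integral_incr_mul_incr (hW : IsBrownianOn P W S T) {u v w : ℝ} (hu : S ≤ u)
    (huv : u ≤ v) (hvw : v ≤ w) (hw : w ≤ T) (j k : Fin m) :
    ∫ ω, (W v ω j - W u ω j) * (W w ω k - W v ω k) ∂P = 0 := by
  have hind := hW.indep_increments.indepFun_sub_sub
    (r := ⟨u, hu, huv.trans (hvw.trans hw)⟩) (s := ⟨v, hu.trans huv, hvw.trans hw⟩)
    (t := ⟨w, hu.trans (huv.trans hvw), hw⟩) huv hvw
  have hind2 := hind.comp (φ := fun x : Vec m => x j) (ψ := fun x : Vec m => x k)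
    (by fun_prop) (by fun_prop)
  have h := hind2.integral_mul_eq_mul_integral
    (hW.memLp_incr hu huv (hvw.trans hw) j).1 (hW.memLp_incr (hu.trans huv) hvw hw k).1
  have h' : ∫ ω, (W v ω j - W u ω j) * (W w ω k - W v ω k) ∂P =
    (∫ ω, (W v ω j - W u ω j) ∂P) * ∫ ω, (W w ω k - W v ω k) ∂P := h
  rw [h', hW.integral_incr hu huv (hvw.trans hw) j, zero_mul]

lemma IsBrownianOn.integral_mul_of_le (hW : IsBrownianOn P W S T) {v w : ℝ} (hv : S ≤ v)
    (hvw : v ≤ w) (hw : w ≤ T) (j k : Fin m) :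
    ∫ ω, (W v ω j - W S ω j) * (W w ω k - W S ω k) ∂P = if j = k then v - S else 0 := by
  have h1 := hW.memLp_incr le_rfl hv (hvw.trans hw) j
  have h2 := hW.memLp_incr le_rfl hv (hvw.trans hw) k
  have h3 := hW.memLp_incr hv hvw hw k
  have : ∀ ω, (W v ω j - W S ω j) * (W w ω k - W S ω k) =
      (W v ω j - W S ω j) * (W v ω k - W S ω k) + (W v ω j - W S ω j) * (W w ω k - W v ω k) :=
    fun ω => by ring
  simp_rw [this]
  rw [integral_add (f := fun ω => (W v ω j - W S ω j) * (W v ω k - W S ω k))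
    (g := fun ω => (W v ω j - W S ω j) * (W w ω k - W v ω k))
    (h1.integrable_mul h2) (h1.integrable_mul h3), hW.integral_incr_mul le_rfl hv (hvw.trans hw), hW.integral_incr_mul_incr le_rfl hv hvw hw,
    add_zero]

lemma IsBrownianOn.integral_mul (hW : IsBrownianOn P W S T) {v w : ℝ} (hv : v ∈ Icc S T)
    (hw : w ∈ Icc S T) (j k : Fin m) :
    ∫ ω, (W v ω j - W S ω j) * (W w ω k - W S ω k) ∂P = if j = k then min v w - S else 0 := by
  rcases le_total v w with h | h
  · rw [min_eq_left h, hW.integral_mul_of_le hv.1 h hw.2]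
  · rw [min_eq_right h]
    simp_rw [mul_comm (W v _ j - W S _ j)]
    rw [hW.integral_mul_of_le hw.1 h hv.2]
    simp [eq_comm]

/-- Bilinear expansion of the covariance min(v, w) - S. The result is the length of the overlap of
the two intervals, that is the L² inner product of their indicators. -/
lemma IsBrownianOn.integral_incr_mul_incr_eq (hW : IsBrownianOn P W S T) {u v u' v' : ℝ}
    (hu : S ≤ u) (huv : u ≤ v) (hv : v ≤ T) (hu' : S ≤ u') (huv' : u' ≤ v') (hv' : v' ≤ T)
    (j k : Fin m) :
    ∫ ω, (W v ω j - W u ω j) * (W v' ω k - W u' ω k) ∂P =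
      if j = k then max (min v v' - max u u') 0 else 0 := by
  have hB : ∀ x ∈ Icc S T, ∀ i, MemLp (fun ω => W x ω i - W S ω i) 2 P :=
    fun x hx i => hW.memLp_incr le_rfl hx.1 hx.2 i
  have mu : u ∈ Icc S T := ⟨hu, huv.trans hv⟩
  have mv : v ∈ Icc S T := ⟨hu.trans huv, hv⟩
  have mu' : u' ∈ Icc S T := ⟨hu', huv'.trans hv'⟩
  have mv' : v' ∈ Icc S T := ⟨hu'.trans huv', hv'⟩
  have hI : ∀ x ∈ Icc S T, ∀ y ∈ Icc S T,
      Integrable (fun ω => (W x ω j - W S ω j) * (W y ω k - W S ω k)) P :=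
    fun x hx y hy => (hB x hx j).integrable_mul (hB y hy k)
  have : ∀ ω, (W v ω j - W u ω j) * (W v' ω k - W u' ω k) =
      ((W v ω j - W S ω j) * (W v' ω k - W S ω k) - (W v ω j - W S ω j) * (W u' ω k - W S ω k))
      - ((W u ω j - W S ω j) * (W v' ω k - W S ω k)
        - (W u ω j - W S ω j) * (W u' ω k - W S ω k)) := fun ω => by ring
  simp_rw [this]
  rw [integral_sub (f := fun ω => (W v ω j - W S ω j) * (W v' ω k - W S ω k) -
        (W v ω j - W S ω j) * (W u' ω k - W S ω k))
      (g := fun ω => (W u ω j - W S ω j) * (W v' ω k - W S ω k) -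
        (W u ω j - W S ω j) * (W u' ω k - W S ω k))
      ((hI _ mv _ mv').sub (hI _ mv _ mu')) ((hI _ mu _ mv').sub (hI _ mu _ mu')),
    integral_sub (hI _ mv _ mv') (hI _ mv _ mu'), integral_sub (hI _ mu _ mv') (hI _ mu _ mu'),
    hW.integral_mul mv mv', hW.integral_mul mv mu', hW.integral_mul mu mv', hW.integral_mul mu mu']
  split_ifs
  · grind
  · simp

end Moments

/-- The pairs spanning the graph of the Wiener integral. -/
def IsStep (P : Measure Ω) (W : ℝ → Ω → Vec m) (a b u v : ℝ) (j : Fin m)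
    (p : Lp (Vec m) 2 (leb a b) × Lp ℝ 2 P) : Prop :=
  (p.1 =ᵐ[leb a b] (Ioc u v).indicator (fun _ => EuclideanSpace.single j (1 : ℝ))) ∧
    (p.2 =ᵐ[P] fun ω => W v ω j - W u ω j)

lemma IsStep.mem_wienerGraph {u v : ℝ} {j : Fin m} {p : Lp (Vec m) 2 (leb a b) × Lp ℝ 2 P}
    (hp : IsStep P W a b u v j p) (hu : a ≤ u) (huv : u ≤ v) (hv : v ≤ b) :
    p ∈ wienerGraph P W a b :=
  Submodule.le_topologicalClosure _ (Submodule.subset_span ⟨u, v, hu, huv, hv, j, hp⟩)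

/-- The induction principle for Wiener integrals: a closed linear property needs checking on step
functions only. -/
lemma wienerGraph_le {M : Submodule ℝ (Lp (Vec m) 2 (leb a b) × Lp ℝ 2 P)}
    (hM : IsClosed (M : Set (Lp (Vec m) 2 (leb a b) × Lp ℝ 2 P)))
    (h : ∀ u v j p, a ≤ u → u ≤ v → v ≤ b → IsStep P W a b u v j p → p ∈ M) :
    wienerGraph P W a b ≤ M := by
  refine Submodule.topologicalClosure_minimal _ (Submodule.span_le.2 ?_) hM
  rintro p ⟨u, v, hu, huv, hv, j, hp⟩
  exact h u v j p hu huv hv hp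

lemma IsBrownianOn.exists_isStep (hW : IsBrownianOn P W S T) (a b : ℝ) {u v : ℝ} (hu : S ≤ u)
    (huv : u ≤ v) (hv : v ≤ T) (j : Fin m) : ∃ p, IsStep P W a b u v j p := by
  have h1 : MemLp ((Ioc u v).indicator (fun _ => EuclideanSpace.single j (1 : ℝ) : ℝ → Vec m)) 2
      (leb a b) := memLp_indicator_const _ measurableSet_Ioc _ (Or.inr (measure_ne_top _ _))
  exact ⟨(h1.toLp _, (hW.memLp_incr hu huv hv j).toLp _), h1.coeFn_toLp,
    (hW.memLp_incr hu huv hv j).coeFn_toLp⟩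

lemma IsBrownianOn.inner_isStep (hW : IsBrownianOn P W S T) {u v u' v' : ℝ} {j k : Fin m}
    (hu : S ≤ u) (huv : u ≤ v) (hv : v ≤ T) (hu' : S ≤ u') (huv' : u' ≤ v') (hv' : v' ≤ T)
    {p q : Lp (Vec m) 2 (leb S T) × Lp ℝ 2 P}
    (hp : IsStep P W S T u v j p) (hq : IsStep P W S T u' v' k q) :
    inner ℝ p.1 q.1 = inner ℝ p.2 q.2 := by
  rw [L2.inner_def, L2.inner_def]
  have h2 : ∫ ω, inner ℝ (p.2 ω) (q.2 ω) ∂P = if j = k then max (min v v' - max u u') 0 else 0 := by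
    rw [← hW.integral_incr_mul_incr_eq hu huv hv hu' huv' hv']
    refine integral_congr_ae ?_
    filter_upwards [hp.2, hq.2] with ω h1 h2
    rw [h1, h2]
    simp [mul_comm]
  have h1 : ∫ r, inner ℝ (p.1 r) (q.1 r) ∂(leb S T) =
      ∫ r, (Ioc (max u u') (min v v')).indicator
        (fun _ => if j = k then (1 : ℝ) else 0) r ∂(leb S T) := by
    refine integral_congr_ae ?_
    filter_upwards [hp.1, hq.1] with r h1 h2
    rw [h1, h2, ← Ioc_inter_Ioc]
    by_cases hr : r ∈ Ioc u v <;> by_cases hr' : r ∈ Ioc u' v' <;>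
      simp [indicator, hr, hr', EuclideanSpace.inner_single_left, -mem_Ioc]
  rw [h1, h2, integral_indicator measurableSet_Ioc, Measure.restrict_restrict measurableSet_Ioc,
    inter_eq_left.2]
  · simp [measureReal_def, ENNReal.toReal_ofReal']
  · intro r hr
    exact ⟨((hu.trans (le_max_left _ _)).trans hr.1.le), hr.2.trans ((min_le_left _ _).trans hv)⟩

/-- The Itô isometry. The bilinear form ⟨p.1, q.1⟩ - ⟨p.2, q.2⟩ vanishes on pairs of steps and is
extended to the closed span in one argument at a time; the diagonal gives the norms. -/
lemma IsBrownianOn.norm_eq_of_mem_wienerGraph (hW : IsBrownianOn P W S T)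
    {p : Lp (Vec m) 2 (leb S T) × Lp ℝ 2 P} (hp : p ∈ wienerGraph P W S T) :
    ‖p.1‖ = ‖p.2‖ := by
  have key : ∀ q ∈ wienerGraph P W S T, ∀ p ∈ wienerGraph P W S T,
      inner ℝ p.1 q.1 - inner ℝ p.2 q.2 = (0 : ℝ) := by
    let B : (Lp (Vec m) 2 (leb S T) × Lp ℝ 2 P) → (Lp (Vec m) 2 (leb S T) × Lp ℝ 2 P) →L[ℝ] ℝ :=
      fun q => (innerSL ℝ q.1).comp (ContinuousLinearMap.fst ℝ _ _) -
        (innerSL ℝ q.2).comp (ContinuousLinearMap.snd ℝ _ _)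
    have hB : ∀ q p, B q p = inner ℝ q.1 p.1 - inner ℝ q.2 p.2 := fun q p => rfl
    have hsymm : ∀ q p, B q p = B p q := fun q p => by
      rw [hB, hB, real_inner_comm, real_inner_comm p.2]
    have h1 : ∀ u v j q, S ≤ u → u ≤ v → v ≤ T → IsStep P W S T u v j q →
        wienerGraph P W S T ≤ LinearMap.ker (B q).toLinearMap := by
      intro u v j q hu huv hv hq
      refine wienerGraph_le (B q).isClosed_ker ?_
      intro u' v' k p hu' huv' hv' hp
      rw [LinearMap.mem_ker]
      exact sub_eq_zero.2 (hW.inner_isStep hu huv hv hu' huv' hv' hq hp)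
    have h2 : ∀ p ∈ wienerGraph P W S T,
        wienerGraph P W S T ≤ LinearMap.ker (B p).toLinearMap := by
      intro p hp
      refine wienerGraph_le (B p).isClosed_ker ?_
      intro u v j q hu huv hv hq
      rw [LinearMap.mem_ker]
      have := h1 u v j q hu huv hv hq hp
      rw [LinearMap.mem_ker] at this
      exact (hsymm p q).trans this
    intro q hq p hp
    exact h2 p hp hq
  have := key p hp p hp
  rw [real_inner_self_eq_norm_sq, real_inner_self_eq_norm_sq, sub_eq_zero] at this
  exact (sq_eq_sq₀ (norm_nonneg _) (norm_nonneg _)).1 this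

/-- Extension by zero carries steps inside [s,t] to steps inside [S,T] with the same increment, and
it is continuous. -/
lemma extendL_mem_wienerGraph (hs : S ≤ s) (ht : t ≤ T)
    {p : Lp (Vec m) 2 (leb s t) × Lp ℝ 2 P} (hp : p ∈ wienerGraph P W s t) :
    (extendL _ hs ht p.1, p.2) ∈ wienerGraph P W S T := by
  let f := (extendL (Vec m) hs ht).prodMap (ContinuousLinearMap.id ℝ (Lp ℝ 2 P))
  have hf : ∀ p, f p = (extendL (Vec m) hs ht p.1, p.2) := fun p => rfl
  have hle : wienerGraph P W s t ≤ (wienerGraph P W S T).comap f.toLinearMap := by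
    refine wienerGraph_le ?_ ?_
    · rw [Submodule.comap_coe]
      exact (Submodule.isClosed_topologicalClosure _).preimage f.continuous
    · intro u v j p hu huv hv hp
      rw [Submodule.mem_comap, ContinuousLinearMap.coe_coe, hf]
      refine IsStep.mem_wienerGraph (u := u) (v := v) (j := j) ⟨?_, hp.2⟩ (hs.trans hu) huv
        (hv.trans ht)
      have h1 := (extendL_coe hs ht p.1).trans (indicator_ae_leb hs ht hp.1)
      rwa [indicator_indicator, inter_eq_right.2] at h1
      exact fun r hr => ⟨hu.trans hr.1.le, hr.2.trans hv⟩
  have h := hle hp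
  rwa [Submodule.mem_comap, ContinuousLinearMap.coe_coe, hf] at h

lemma IsBrownianOn.norm_eq_of_mem_wienerGraph' (hW : IsBrownianOn P W S T) (hs : S ≤ s)
    (ht : t ≤ T) {p : Lp (Vec m) 2 (leb s t) × Lp ℝ 2 P} (hp : p ∈ wienerGraph P W s t) :
    ‖p.1‖ = ‖p.2‖ := by
  rw [← hW.norm_eq_of_mem_wienerGraph (extendL_mem_wienerGraph hs ht hp), norm_extendL]

lemma mem_lpMeas_two_iff {Ω F : Type*} [NormedAddCommGroup F] [NormedSpace ℝ F]
    {𝒢 : MeasurableSpace Ω} [mΩ : MeasurableSpace Ω] {P : Measure Ω} {f : Lp F 2 P} :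
    f ∈ lpMeas F ℝ 𝒢 2 P ↔ AEStronglyMeasurable[𝒢] f P :=
  mem_lpMeas_iff_aestronglyMeasurable

lemma isClosed_lpMeas {Ω : Type*} (F : Type*) [NormedAddCommGroup F] [NormedSpace ℝ F]
    [CompleteSpace F] {𝒢 : MeasurableSpace Ω} [mΩ : MeasurableSpace Ω] {P : Measure Ω}
    (h : 𝒢 ≤ mΩ) : IsClosed (lpMeas F ℝ 𝒢 2 P : Set (Lp F 2 P)) := by
  convert isClosed_aestronglyMeasurable (F := F) (p := 2) (μ := P) h using 1
  ext f
  exact mem_lpMeas_two_iff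

lemma IsWienerIntegral.aestronglyMeasurable (h : ∀ r ∈ Icc a b, Measurable (W r))
    {φ : Lp (Vec m) 2 (leb a b)} {I : Lp ℝ 2 P} (hI : IsWienerIntegral P W a b φ I) :
    AEStronglyMeasurable[incrSigma W a b] I P := by
  have hle := incrSigma_le_of_measurable h
  have : wienerGraph P W a b ≤ (lpMeas ℝ ℝ (incrSigma W a b) 2 P).comap
      (LinearMap.snd ℝ (Lp (Vec m) 2 (leb a b)) (Lp ℝ 2 P)) := by
    refine wienerGraph_le ?_ ?_
    · rw [Submodule.comap_coe]
      exact (isClosed_lpMeas (P := P) ℝ hle).preimage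
        (continuous_snd (X := Lp (Vec m) 2 (leb a b)) (Y := Lp ℝ 2 P))
    · intro u v j p hu huv hv hp
      refine mem_lpMeas_two_iff.2 ⟨_, ?_, hp.2⟩
      have h1 := measurable_incrSigma_sub (W := W) (r := v) (r' := u) ⟨hu.trans huv, hv⟩
        ⟨hu, huv.trans hv⟩
      have h2 : Measurable[incrSigma W a b] fun ω => (W v ω - W u ω) j :=
        Measurable.comp (g := fun x : Vec m => x j) (by fun_prop) h1
      exact h2.stronglyMeasurable
  exact mem_lpMeas_two_iff.1 (this hI)

lemma indicator_Ioc_clamp {E : Type*} [Zero E] (u v : ℝ) (c : E) :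
    (Ioc u v).indicator (fun _ => c) =ᵐ[leb s t]
      (Ioc (max s (min u t)) (max s (min v t))).indicator (fun _ => c) := by
  -- The left endpoint is the one point of [s,t] where the two indicators can differ: the projected
  -- interval never contains s.
  have hne : ∀ᵐ r ∂(leb s t), r ≠ s := by
    rw [ae_iff]; simp
  filter_upwards [hne, ae_restrict_mem measurableSet_Icc] with r h1 h2
  have h3 : s < r := lt_of_le_of_ne h2.1 (Ne.symm h1)
  have h4 : r ≤ t := h2.2
  have : r ∈ Ioc u v ↔ r ∈ Ioc (max s (min u t)) (max s (min v t)) := by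
    simp only [mem_Ioc, max_lt_iff, min_lt_iff, le_max_iff, le_min_iff]
    constructor
    · rintro ⟨h5, h6⟩
      exact ⟨⟨h3, Or.inl h5⟩, Or.inr ⟨h6, h4⟩⟩
    · rintro ⟨⟨-, h5⟩, h6⟩
      exact ⟨h5.resolve_right (not_lt.2 h4), (h6.resolve_left (not_le.2 h3)).1⟩
  by_cases hr : r ∈ Ioc u v
  · rw [indicator_of_mem hr, indicator_of_mem (this.1 hr)]
  · rw [indicator_of_notMem hr, indicator_of_notMem (fun h => hr (this.2 h))]

/-- A Wiener integral over `[S, T]` is the sum of a Wiener integral over `[s, t]` and of a random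
variable that depends only on the increments before `s` and after `t`. -/
theorem IsBrownianOn.exists_wiener_split (hW : IsBrownianOn P W S T) (hs : S ≤ s) (hst : s ≤ t)
    (ht : t ≤ T) {φ : Lp (Vec m) 2 (leb S T)} {I : Lp ℝ 2 P} (hI : IsWienerIntegral P W S T φ I) :
    ∃ I' : Lp ℝ 2 P, IsWienerIntegral P W s t (restrictL _ hs ht φ) I' ∧
      AEStronglyMeasurable[sideSigma W S s t T] (I - I' : Lp ℝ 2 P) P := by
  have hle : sideSigma W S s t T ≤ mΩ := sup_le
    (incrSigma_le_of_measurable fun r hr => hW.measurable r ⟨hr.1, hr.2.trans (hst.trans ht)⟩)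
    (incrSigma_le_of_measurable fun r hr => hW.measurable r ⟨hs.trans (hst.trans hr.1), hr.2⟩)
  -- On step functions the splitting comes from projecting both endpoints onto [s,t]; linearity
  -- gives it on the span.
  have hspan : ∀ p ∈ (wienerGraph P W S T : Set (Lp (Vec m) 2 (leb S T) × Lp ℝ 2 P)),
      p ∈ (Submodule.span ℝ {p : Lp (Vec m) 2 (leb S T) × Lp ℝ 2 P |
        ∃ u v : ℝ, S ≤ u ∧ u ≤ v ∧ v ≤ T ∧ ∃ j : Fin m, IsStep P W S T u v j p}) →
      ∃ I' : Lp ℝ 2 P, IsWienerIntegral P W s t (restrictL _ hs ht p.1) I' ∧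
        p.2 - I' ∈ lpMeas ℝ ℝ (sideSigma W S s t T) 2 P := by
    intro p _ hp
    induction hp using Submodule.span_induction with
    | mem p hp =>
      obtain ⟨u, v, hu, huv, hv, j, hp⟩ := hp
      obtain ⟨q, hq⟩ := hW.exists_isStep s t (u := max s (min u t)) (v := max s (min v t))
        (hs.trans (le_max_left _ _)) (max_le_max le_rfl (min_le_min huv le_rfl))
        ((max_le hst (min_le_right _ _)).trans ht) j
      have hq1 : restrictL _ hs ht p.1 = q.1 := by
        refine Lp.ext ((restrictL_coe hs ht _).trans (Filter.EventuallyEq.trans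
          (ae_mono (leb_mono hs ht) hp.1) ((indicator_Ioc_clamp u v _).trans hq.1.symm)))
      refine ⟨q.2, ?_, ?_⟩
      · rw [hq1]
        exact hq.mem_wienerGraph (le_max_left _ _) (max_le_max le_rfl (min_le_min huv le_rfl))
          (max_le hst (min_le_right _ _))
      · rw [mem_lpMeas_two_iff]
        have h1 := measurable_sub_clamp (W := W) (T := T) hs hst (x := v) ⟨hu.trans huv, hv⟩
        have h2 := measurable_sub_clamp (W := W) (T := T) hs hst (x := u) ⟨hu, huv.trans hv⟩
        have h1' : Measurable[sideSigma W S s t T] fun ω => (W v ω - W (max s (min v t)) ω) j :=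
          Measurable.comp (g := fun x : Vec m => x j) (by fun_prop) h1
        have h2' : Measurable[sideSigma W S s t T] fun ω => (W u ω - W (max s (min u t)) ω) j :=
          Measurable.comp (g := fun x : Vec m => x j) (by fun_prop) h2
        refine ⟨_, (h1'.sub h2').stronglyMeasurable, ?_⟩
        filter_upwards [Lp.coeFn_sub p.2 q.2, hp.2, hq.2] with ω e1 e2 e3
        rw [e1, Pi.sub_apply, e2, e3]
        simp only [PiLp.sub_apply, Pi.sub_apply]
        ring
    | zero =>
      refine ⟨0, ?_, by simp⟩
      have := (wienerGraph P W s t).zero_mem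
      rwa [IsWienerIntegral, Prod.fst_zero, map_zero]
    | add x y hx hy ihx ihy =>
      obtain ⟨I1, h1, h1'⟩ := ihx (Submodule.le_topologicalClosure _ hx)
      obtain ⟨I2, h2, h2'⟩ := ihy (Submodule.le_topologicalClosure _ hy)
      refine ⟨I1 + I2, ?_, ?_⟩
      · have := (wienerGraph P W s t).add_mem h1 h2
        simpa [IsWienerIntegral] using this
      · have := Submodule.add_mem _ h1' h2'
        rwa [← add_sub_add_comm] at this
    | smul c x hx ih =>
      obtain ⟨I1, h1, h1'⟩ := ih (Submodule.le_topologicalClosure _ hx)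
      refine ⟨c • I1, ?_, ?_⟩
      · have := (wienerGraph P W s t).smul_mem c h1
        simpa [IsWienerIntegral] using this
      · have := Submodule.smul_mem _ c h1'
        rwa [smul_sub] at this
  obtain ⟨p, hp, hlim⟩ := mem_closure_iff_seq_limit.1
    (show (φ, I) ∈ closure (_ : Set (Lp (Vec m) 2 (leb S T) × Lp ℝ 2 P)) from hI)
  choose q hq hq' using fun k => hspan (p k) (Submodule.le_topologicalClosure _ (hp k)) (hp k)
  have h1 : Filter.Tendsto (fun k => restrictL _ hs ht (p k).1) Filter.atTop
      (nhds (restrictL _ hs ht φ)) :=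
    ((restrictL _ hs ht).continuous.tendsto φ).comp ((continuous_fst.tendsto _).comp hlim)
  -- The inner integrals are chosen separately for each k. The isometry nevertheless gives their
  -- mutual distances, so they form a Cauchy sequence, and measurability of the remainder survives
  -- the L² limit.
  have hdist : ∀ k l, dist (q k) (q l) =
      dist (restrictL _ hs ht (p k).1) (restrictL _ hs ht (p l).1) := by
    intro k l
    have := hW.norm_eq_of_mem_wienerGraph' hs ht ((wienerGraph P W s t).sub_mem (hq k) (hq l))
    rw [dist_eq_norm, dist_eq_norm]
    exact this.symm
  have hcauchy : CauchySeq q := by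
    have := h1.cauchySeq
    rw [Metric.cauchySeq_iff] at this ⊢
    simpa only [hdist] using this
  obtain ⟨I', hI'⟩ := cauchySeq_tendsto_of_complete hcauchy
  refine ⟨I', ?_, ?_⟩
  · exact (Submodule.isClosed_topologicalClosure _).mem_of_tendsto (h1.prodMk_nhds hI')
      (.of_forall hq)
  · refine mem_lpMeas_two_iff.1 ?_
    have hsub : Filter.Tendsto (fun k => (p k).2 - q k) Filter.atTop (nhds (I - I')) :=
      ((continuous_snd.tendsto _).comp hlim).sub hI'
    exact (isClosed_lpMeas (P := P) ℝ hle).mem_of_tendsto hsub (.of_forall hq')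

end Wiener

/-! ### Comparison of the sigma-algebras -/

section Sigma

variable {Ω : Type*} {m : ℕ}

lemma nullSigma_le [mΩ : MeasurableSpace Ω] (P : Measure Ω) : nullSigma P ≤ mΩ :=
  MeasurableSpace.generateFrom_le fun _ hA => hA.1

lemma outerSigma_eq (𝔽 : MeasurableSpace Ω) [mΩ : MeasurableSpace Ω] (P : Measure Ω)
    (W : ℝ → Ω → Vec m) (S s t T : ℝ) :
    outerSigma 𝔽 P W S s t T = (𝔽 ⊔ nullSigma P) ⊔ sideSigma W S s t T := by
  rw [outerSigma, sideSigma]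
  simp only [sup_assoc, sup_left_comm, sup_comm]

lemma sideSigma_le_incrSigma (W : ℝ → Ω → Vec m) {S s t T : ℝ} (hs : S ≤ s) (hst : s ≤ t)
    (ht : t ≤ T) : sideSigma W S s t T ≤ incrSigma W S T :=
  sup_le
    (incrSigma_le fun _ hr => measurable_incrSigma_sub ⟨hr.1, hr.2.trans (hst.trans ht)⟩
      ⟨le_rfl, hs.trans (hst.trans ht)⟩)
    (incrSigma_le fun _ hr => measurable_incrSigma_sub ⟨hs.trans (hst.trans hr.1), hr.2⟩
      ⟨hs.trans hst, ht⟩)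

lemma sideSigma_sup_incrSigma (W : ℝ → Ω → Vec m) {S s t T : ℝ} (hs : S ≤ s) (hst : s ≤ t)
    (ht : t ≤ T) : sideSigma W S s t T ⊔ incrSigma W s t = incrSigma W S T := by
  refine le_antisymm (sup_le (sideSigma_le_incrSigma W hs hst ht)
    (incrSigma_le fun r hr => measurable_incrSigma_sub ⟨hs.trans hr.1, hr.2.trans ht⟩
      ⟨hs, hst.trans ht⟩)) (incrSigma_le fun r hr => ?_)
  set c : ℝ → ℝ := fun x => max s (min x t)
  have hc : ∀ x, c x ∈ Icc s t := fun x => ⟨le_max_left _ _, max_le hst (min_le_right _ _)⟩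
  have h1 := (measurable_sub_clamp (W := W) (T := T) hs hst hr).mono
    (le_sup_left (b := incrSigma W s t)) le_rfl
  have h2 := (measurable_sub_clamp (W := W) (T := T) (x := S) hs hst
    ⟨le_rfl, hr.1.trans hr.2⟩).mono (le_sup_left (b := incrSigma W s t)) le_rfl
  have h3 := (measurable_incrSigma_sub (W := W) (hc r) (hc S)).mono
    (le_sup_right (a := sideSigma W S s t T)) le_rfl
  have : (fun ω => W r ω - W S ω) = (fun ω => W r ω - W (c r) ω) - (fun ω => W S ω - W (c S) ω) +
      (fun ω => W (c r) ω - W (c S) ω) := by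
    ext1 ω
    simp only [Pi.add_apply, Pi.sub_apply]
    abel
  rw [this]
  exact (h1.sub h2).add h3

/-- Inner and outer increments together generate all increments over [S,T]. Hence the measurability
requirements on X and Y are the same in both notions of integral. -/
lemma fullSigma_outerSigma (𝔽 : MeasurableSpace Ω) [mΩ : MeasurableSpace Ω] (P : Measure Ω)
    (W : ℝ → Ω → Vec m) {S s t T : ℝ} (hs : S ≤ s) (hst : s ≤ t) (ht : t ≤ T) :
    fullSigma (outerSigma 𝔽 P W S s t T) P W s t = fullSigma 𝔽 P W S T := by
  rw [fullSigma, outerSigma_eq, fullSigma, ← sideSigma_sup_incrSigma W hs hst ht]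
  refine le_antisymm ?_ ?_
  · refine sup_le (sup_le (sup_le (sup_le ?_ ?_) ?_) ?_) ?_
    · exact le_sup_of_le_left le_sup_left
    · exact le_sup_right
    · exact le_sup_of_le_left (le_sup_of_le_right le_sup_left)
    · exact le_sup_of_le_left (le_sup_of_le_right le_sup_right)
    · exact le_sup_right
  · refine sup_le (sup_le ?_ (sup_le ?_ ?_)) le_sup_right
    · exact le_sup_of_le_left (le_sup_of_le_left (le_sup_of_le_left le_sup_left))
    · exact le_sup_of_le_left (le_sup_of_le_left le_sup_right)
    · exact le_sup_of_le_left le_sup_right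

lemma fullSigma_le {𝔽 : MeasurableSpace Ω} [mΩ : MeasurableSpace Ω] (P : Measure Ω)
    {W : ℝ → Ω → Vec m} {a b : ℝ} (h𝔽 : 𝔽 ≤ mΩ) (h : ∀ r ∈ Icc a b, Measurable (W r)) :
    fullSigma 𝔽 P W a b ≤ mΩ :=
  sup_le (sup_le h𝔽 (incrSigma_le_of_measurable h)) (nullSigma_le P)

lemma outerSigma_le {𝔽 : MeasurableSpace Ω} [mΩ : MeasurableSpace Ω] (P : Measure Ω)
    {W : ℝ → Ω → Vec m} {S s t T : ℝ} (h𝔽 : 𝔽 ≤ mΩ) (hs : S ≤ s) (hst : s ≤ t) (ht : t ≤ T)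
    (h : ∀ r ∈ Icc S T, Measurable (W r)) : outerSigma 𝔽 P W S s t T ≤ mΩ := by
  rw [outerSigma_eq]
  exact sup_le (sup_le h𝔽 (nullSigma_le P))
    ((sideSigma_le_incrSigma W hs hst ht).trans (incrSigma_le_of_measurable h))

end Sigma

/-! ### Smooth random fields -/

section Field

lemma IsSmoothField.measurable_eval {Ω : Type*} {𝒢 ℋ : MeasurableSpace Ω} {n : ℕ}
    {f : (Fin n → ℝ) → Ω → ℝ} (hf : IsSmoothField 𝒢 f) (hle : 𝒢 ≤ ℋ) {J : Ω → Fin n → ℝ}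
    (hJ : Measurable[ℋ] J) : Measurable[ℋ] fun ω => f (J ω) ω := by
  have h := measurable_uncurry_of_continuous_of_measurable (u := f)
    (fun ω => (hf.smooth ω).continuous) (fun x => (hf.measurable x).mono hle le_rfl)
  exact h.comp (hJ.prodMk measurable_id)

/-- Translation changes no derivative bound, and evaluating a field that is continuous in x at a
measurable point is measurable. This is how the outer part of a Wiener integral is absorbed into the
field. -/
lemma IsSmoothField.comp_add {Ω : Type*} {𝒢 ℋ : MeasurableSpace Ω} {n : ℕ}
    {f : (Fin n → ℝ) → Ω → ℝ} (hf : IsSmoothField 𝒢 f) (hle : 𝒢 ≤ ℋ) {J : Ω → Fin n → ℝ}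
    (hJ : Measurable[ℋ] J) : IsSmoothField ℋ fun x ω => f (x + J ω) ω where
  smooth ω := (hf.smooth ω).comp (contDiff_id.add contDiff_const)
  bounded ω k := by
    obtain ⟨C, hC⟩ := hf.bounded ω k
    refine ⟨C, fun x => ?_⟩
    have := iteratedFDeriv_comp_add_right (𝕜 := ℝ) (f := fun y => f y ω) k (J ω) x
    rw [this]
    exact hC _
  measurable x := hf.measurable_eval hle (measurable_const.add hJ)

end Field

/-! ### Integrability as existence of an integral -/

section Integral

variable {Ω : Type*} {d m : ℕ}

lemma aestronglyMeasurable_pi {ℋ : MeasurableSpace Ω} [mΩ : MeasurableSpace Ω] {P : Measure Ω}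
    {n : ℕ} {I : Fin n → Ω → ℝ} (hI : ∀ i, AEStronglyMeasurable[ℋ] (I i) P) :
    ∃ J : Ω → Fin n → ℝ, Measurable[ℋ] J ∧ ∀ᵐ ω ∂P, (fun i => I i ω) = J ω := by
  choose J hJ hIJ using hI
  refine ⟨fun ω i => J i ω, @measurable_pi_lambda _ _ _ ℋ _ _ fun i => (hJ i).measurable, ?_⟩
  filter_upwards [ae_all_iff.2 hIJ] with ω h
  exact funext h

lemma aestronglyMeasurable_of_mem_malliavinElementary {𝔽 : MeasurableSpace Ω}
    [mΩ : MeasurableSpace Ω] {P : Measure Ω} {W : ℝ → Ω → Vec m} {a b : ℝ}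
    (hW : ∀ r ∈ Icc a b, Measurable (W r))
    {p : Lp (Vec d) 2 P × Lp (PathSpace d m a b) 2 P}
    (hp : p ∈ malliavinElementary d 𝔽 P W a b) :
    AEStronglyMeasurable[fullSigma 𝔽 P W a b] p.1 P := by
  obtain ⟨n, -, φ, I, hI, f, hf, h, h1, -⟩ := hp
  obtain ⟨J, hJ, hIJ⟩ := aestronglyMeasurable_pi (fun i => (hI i).aestronglyMeasurable hW)
  have hJ' : Measurable[fullSigma 𝔽 P W a b] J :=
    hJ.mono (le_sup_of_le_left le_sup_right) le_rfl
  have hm := hf.measurable_eval (ℋ := fullSigma 𝔽 P W a b)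
    (sup_le (le_sup_of_le_left le_sup_left) le_sup_right) hJ'
  refine ⟨_, (hm.stronglyMeasurable.smul_const h), ?_⟩
  filter_upwards [h1, hIJ] with ω e1 e2
  rw [e1, e2]

/-- A bounded functional of the first component of a linear relation is represented by a vector
in any closed subspace containing the domain. -/
lemma exists_inner_eq_of_le {H₁ H₂ : Type*} [NormedAddCommGroup H₁] [InnerProductSpace ℝ H₁]
    [CompleteSpace H₁] [AddCommGroup H₂] [Module ℝ H₂] (D : Submodule ℝ (H₁ × H₂))
    (K : Submodule ℝ H₁) (hK : IsClosed (K : Set H₁)) (hD : ∀ p ∈ D, p.1 ∈ K)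
    (ℓ : H₂ →ₗ[ℝ] ℝ) {c : ℝ} (hc : ∀ p ∈ D, ℓ p.2 ≤ c * ‖p.1‖) :
    ∃ Y ∈ K, ∀ p ∈ D, inner ℝ p.1 Y = ℓ p.2 := by
  -- Applying the one-sided bound to -p makes it two-sided.
  have habs : ∀ p ∈ D, |ℓ p.2| ≤ c * ‖p.1‖ := fun p hp => by
    refine abs_le.2 ⟨?_, hc p hp⟩
    have := hc (-p) (D.neg_mem hp)
    simp only [Prod.snd_neg, map_neg, Prod.fst_neg, norm_neg] at this
    linarith
  let π : D →ₗ[ℝ] H₁ := (LinearMap.fst ℝ H₁ H₂).comp D.subtype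
  let ℓD : D →ₗ[ℝ] ℝ := (ℓ.comp (LinearMap.snd ℝ H₁ H₂)).comp D.subtype
  -- D is not assumed to be the graph of a function. The bound still forces ℓ p.2 = 0 when p.1 = 0,
  -- so ℓ descends to a functional on the first components.
  have hker : LinearMap.ker π ≤ LinearMap.ker ℓD := by
    intro p hp
    have hp' : p.1.1 = 0 := hp
    have := habs p.1 p.2
    rw [hp', norm_zero, mul_zero] at this
    exact abs_nonpos_iff.1 this
  let g : LinearMap.range π →ₗ[ℝ] ℝ :=
    ((LinearMap.ker π).liftQ ℓD hker).comp π.quotKerEquivRange.symm.toLinearMap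
  have hg : ∀ p : D, g ⟨π p, p, rfl⟩ = ℓD p := by
    intro p
    have : π.quotKerEquivRange.symm ⟨π p, p, rfl⟩ = (LinearMap.ker π).mkQ p := by
      rw [LinearEquiv.symm_apply_eq]
      rfl
    simp only [g, LinearMap.comp_apply, LinearEquiv.coe_coe]
    rw [this, Submodule.mkQ_apply, Submodule.liftQ_apply]
  have hgb : ∀ x : LinearMap.range π, ‖g x‖ ≤ c * ‖x‖ := by
    rintro ⟨x, p, rfl⟩
    rw [hg]
    exact habs p.1 p.2
  obtain ⟨G, hG, -⟩ := exists_extension_norm_eq (LinearMap.range π) (g.mkContinuous c hgb)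
  set Y₀ := (InnerProductSpace.toDual ℝ H₁).symm G
  have : CompleteSpace K := hK.completeSpace_coe
  -- Projecting the Riesz vector of the Hahn-Banach extension onto K changes no pairing with
  -- elements of K.
  refine ⟨K.starProjection Y₀, Submodule.starProjection_apply_mem _ _, fun p hp => ?_⟩
  have h1 : inner ℝ p.1 (K.starProjection Y₀) = inner ℝ p.1 Y₀ := by
    have := Submodule.starProjection_inner_eq_zero (K := K) Y₀ p.1 (hD p hp)
    rw [inner_sub_left, sub_eq_zero] at this
    rw [real_inner_comm, ← this, real_inner_comm]
  rw [h1, real_inner_comm, InnerProductSpace.toDual_symm_apply]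
  have := hG ⟨π ⟨p, hp⟩, ⟨p, hp⟩, rfl⟩
  rw [LinearMap.mkContinuous_apply, hg] at this
  exact this

lemma integral_inner_eq_inner {H : Type*} [NormedAddCommGroup H] [InnerProductSpace ℝ H]
    [mΩ : MeasurableSpace Ω] {P : Measure Ω} {X : Ω → H} (hX : MemLp X 2 P) (x : Lp H 2 P) :
    ∫ ω, inner ℝ (x ω) (X ω) ∂P = inner ℝ x (hX.toLp X) := by
  rw [L2.inner_def]
  refine integral_congr_ae ?_
  filter_upwards [hX.coeFn_toLp] with ω h
  rw [h]

lemma IsSkorohodIntegrable.exists_isSkorohodIntegral {𝔽 : MeasurableSpace Ω}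
    [mΩ : MeasurableSpace Ω] {P : Measure Ω} {W : ℝ → Ω → Vec m} {a b : ℝ} (h𝔽 : 𝔽 ≤ mΩ)
    (hW : ∀ r ∈ Icc a b, Measurable (W r)) {X : Ω → PathSpace d m a b}
    (hX : IsSkorohodIntegrable 𝔽 P W a b X) : ∃ Y, IsSkorohodIntegral 𝔽 P W a b X Y := by
  obtain ⟨c, hc0, hc⟩ := hX.2.2
  have hle : malliavinGraph d 𝔽 P W a b ≤
      (lpMeas (Vec d) ℝ (fullSigma 𝔽 P W a b) 2 P).comap (LinearMap.fst ℝ _ _) :=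
    Submodule.span_le.2 fun p hp =>
      mem_lpMeas_two_iff.2 (aestronglyMeasurable_of_mem_malliavinElementary hW hp)
  obtain ⟨Y, hY, h⟩ := exists_inner_eq_of_le (malliavinGraph d 𝔽 P W a b)
    (lpMeas (Vec d) ℝ (fullSigma 𝔽 P W a b) 2 P) (isClosed_lpMeas _ (fullSigma_le P h𝔽 hW))
    (fun p hp => hle hp) (innerSL ℝ (hX.2.1.toLp X)).toLinearMap (c := c) (fun p hp => by
      have := hc p hp
      rw [integral_inner_eq_inner hX.2.1, real_inner_comm] at this
      exact this)
  refine ⟨Y, hX, mem_lpMeas_two_iff.1 hY, fun p hp => ?_⟩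
  have := h p (Submodule.subset_span hp)
  rw [integral_inner_eq_inner hX.2.1, real_inner_comm (hX.2.1.toLp X)]
  rw [L2.inner_def] at this
  exact this

/-- The duality formula extends linearly to the span, and Cauchy-Schwarz then gives the
integrability bound with constant ‖Y‖. -/
lemma isSkorohodIntegral_of_elementary {𝔽 : MeasurableSpace Ω}
    [mΩ : MeasurableSpace Ω] {P : Measure Ω} {W : ℝ → Ω → Vec m} {a b : ℝ}
    {X : Ω → PathSpace d m a b} {Y : Lp (Vec d) 2 P}
    (hXm : AEStronglyMeasurable[fullSigma 𝔽 P W a b] X P) (hX : MemLp X 2 P)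
    (hY : AEStronglyMeasurable[fullSigma 𝔽 P W a b] Y P)
    (h : ∀ p ∈ malliavinElementary d 𝔽 P W a b,
      ∫ ω, inner ℝ (p.1 ω) (Y ω) ∂P = ∫ ω, inner ℝ (p.2 ω) (X ω) ∂P) :
    IsSkorohodIntegral 𝔽 P W a b X Y := by
  refine ⟨⟨hXm, hX, ‖Y‖, norm_nonneg _, ?_⟩, hY, h⟩
  have key : ∀ p ∈ malliavinGraph d 𝔽 P W a b, inner ℝ p.1 Y = inner ℝ p.2 (hX.toLp X) := by
    intro p hp
    induction hp using Submodule.span_induction with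
    | mem p hp =>
      have := h p hp
      rwa [integral_inner_eq_inner hX, ← L2.inner_def] at this
    | zero => simp
    | add x y _ _ hx hy => rw [Prod.fst_add, Prod.snd_add, inner_add_left, inner_add_left, hx, hy]
    | smul c x _ hx =>
      rw [Prod.smul_fst, Prod.smul_snd, real_inner_smul_left, real_inner_smul_left, hx]
  intro p hp
  rw [integral_inner_eq_inner hX, ← key p hp, mul_comm]
  exact real_inner_le_norm _ _

end Integral

/-! ### Elementary variables over [S,T] as elementary variables over [s,t] -/

section Transfer

variable {Ω : Type*} {d m : ℕ}

/-- Each I i is an inner integral I' i plus an outer variable J i. The shifted field f(x + J(ω), ω),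
evaluated at I', returns the same random variable, and its partial derivatives at I' are those of f
at I. -/
lemma restrict_mem_malliavinElementary {𝔽 : MeasurableSpace Ω} [mΩ : MeasurableSpace Ω]
    {P : Measure Ω} {W : ℝ → Ω → Vec m} {S s t T : ℝ} (hW : IsBrownianOn P W S T)
    (hs : S ≤ s) (hst : s ≤ t) (ht : t ≤ T)
    {p : Lp (Vec d) 2 P × Lp (PathSpace d m S T) 2 P}
    (hp : p ∈ malliavinElementary d 𝔽 P W S T) :
    (p.1, (restrictL (Mat d m) hs ht).compLp p.2) ∈
      malliavinElementary d (outerSigma 𝔽 P W S s t T) P W s t := by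
  obtain ⟨n, hn, φ, I, hI, f, hf, h, h1, h2⟩ := hp
  choose I' hI' hJ using fun i => hW.exists_wiener_split hs hst ht (hI i)
  obtain ⟨J, hJm, hJe⟩ := aestronglyMeasurable_pi hJ
  have hle : sideSigma W S s t T ≤ outerSigma 𝔽 P W S s t T ⊔ nullSigma P := by
    rw [outerSigma_eq]
    exact le_sup_of_le_left le_sup_right
  have hle' : 𝔽 ⊔ nullSigma P ≤ outerSigma 𝔽 P W S s t T ⊔ nullSigma P := by
    rw [outerSigma_eq]
    exact le_sup_of_le_left le_sup_left
  have hadd : ∀ᵐ ω ∂P, (fun i => I i ω) = (fun i => I' i ω) + J ω := by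
    filter_upwards [hJe, ae_all_iff.2 fun i => Lp.coeFn_sub (I i) (I' i)] with ω e1 e2
    rw [← e1]
    ext i
    rw [Pi.add_apply, e2 i, Pi.sub_apply]
    ring
  refine ⟨n, hn, fun i => restrictL _ hs ht (φ i), I', hI', fun x ω => f (x + J ω) ω,
    hf.comp_add hle' (hJm.mono hle le_rfl), h, ?_, ?_⟩
  · filter_upwards [h1, hadd] with ω e1 e2
    rw [e1, e2]
  · filter_upwards [h2, hadd, (restrictL (Mat d m) hs ht).coeFn_compLp p.2] with ω e1 e2 e3
    rw [eq_sum_smul_outerPath_iff] at e1 ⊢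
    rw [e3, e1, map_sum]
    refine Finset.sum_congr rfl fun i _ => ?_
    rw [map_smul, restrictL_outerPath, e2,
      fderiv_comp_add_right (f := fun x => f x ω) (J ω)]

end Transfer

/-! ### Functions with bounded derivatives -/

section BoundedDerivs

/-- Smooth functions that are bounded together with all their derivatives. -/
def HasBoundedDerivs {E : Type*} [NormedAddCommGroup E] [NormedSpace ℝ E] (g : E → ℝ) : Prop :=
  ContDiff ℝ ((⊤ : ℕ∞) : WithTop ℕ∞) g ∧ ∀ k : ℕ, ∃ C : ℝ, ∀ x, ‖iteratedFDeriv ℝ k g x‖ ≤ C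

variable {E F : Type*} [NormedAddCommGroup E] [NormedSpace ℝ E] [NormedAddCommGroup F]
  [NormedSpace ℝ F]

lemma HasBoundedDerivs.mul {f g : E → ℝ} (hf : HasBoundedDerivs f) (hg : HasBoundedDerivs g) :
    HasBoundedDerivs fun x => f x * g x := by
  refine ⟨hf.1.mul hg.1, fun k => ?_⟩
  choose Cf hCf using hf.2
  choose Cg hCg using hg.2
  refine ⟨∑ i ∈ Finset.range (k + 1), (k.choose i : ℝ) * Cf i * Cg (k - i), fun x => ?_⟩
  refine (norm_iteratedFDeriv_mul_le hf.1 hg.1 x (by exact_mod_cast le_top)).trans ?_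
  refine Finset.sum_le_sum fun i _ => ?_
  have h1 : 0 ≤ Cf i := (norm_nonneg _).trans (hCf i x)
  gcongr
  · exact hCf i x
  · exact hCg _ x

lemma HasBoundedDerivs.comp {f : E → ℝ} (hf : HasBoundedDerivs f) (L : F →L[ℝ] E) :
    HasBoundedDerivs fun x => f (L x) := by
  refine ⟨hf.1.comp L.contDiff, fun k => ?_⟩
  obtain ⟨C, hC⟩ := hf.2 k
  refine ⟨C * ∏ _i : Fin k, ‖L‖, fun x => ?_⟩
  have h := L.iteratedFDeriv_comp_right hf.1 x (i := k) (by exact_mod_cast le_top)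
  have h' : iteratedFDeriv ℝ k (fun x => f (L x)) x = _ := h
  rw [h']
  refine (ContinuousMultilinearMap.norm_compContinuousLinearMap_le _ _).trans ?_
  gcongr
  exact hC _

lemma HasBoundedDerivs.const_mul {f : E → ℝ} (hf : HasBoundedDerivs f) (c : ℝ) :
    HasBoundedDerivs fun x => c * f x := by
  refine ⟨contDiff_const.mul hf.1, fun k => ?_⟩
  obtain ⟨C, hC⟩ := hf.2 k
  refine ⟨|c| * C, fun x => ?_⟩
  have h := iteratedFDeriv_const_smul_apply (𝕜 := ℝ) (i := k) (a := c) (f := f) (x := x)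
    (hf.1.contDiffAt.of_le (by exact_mod_cast le_top))
  have h' : iteratedFDeriv ℝ k (fun x => c * f x) x = c • iteratedFDeriv ℝ k f x := h
  rw [h', norm_smul, Real.norm_eq_abs]
  gcongr
  exact hC x

lemma hasBoundedDerivs_cos : HasBoundedDerivs Real.cos :=
  ⟨Real.contDiff_cos, fun k => ⟨1, fun x => by
    rw [norm_iteratedFDeriv_eq_norm_iteratedDeriv]
    exact Real.abs_iteratedDeriv_cos_le_one k x⟩⟩

lemma hasBoundedDerivs_sin : HasBoundedDerivs Real.sin :=
  ⟨Real.contDiff_sin, fun k => ⟨1, fun x => by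
    rw [norm_iteratedFDeriv_eq_norm_iteratedDeriv]
    exact Real.abs_iteratedDeriv_sin_le_one k x⟩⟩

lemma hasBoundedDerivs_of_hasCompactSupport {f : E → ℝ}
    (hf : ContDiff ℝ ((⊤ : ℕ∞) : WithTop ℕ∞) f) (hc : HasCompactSupport f) :
    HasBoundedDerivs f := by
  refine ⟨hf, fun k => ?_⟩
  have h1 : Continuous (iteratedFDeriv ℝ k f) :=
    hf.continuous_iteratedFDeriv (by exact_mod_cast le_top)
  exact (hc.iteratedFDeriv k).exists_bound_of_continuous h1

end BoundedDerivs

/-! ### Mollification of random fields -/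

section Mollification

variable {Ω : Type*}

/-- The directional derivative is the pointwise limit of difference quotients with step 1/k. -/
lemma measurable_fderiv_field {𝒢 : MeasurableSpace Ω} {E : Type*} [NormedAddCommGroup E]
    [NormedSpace ℝ E] {f : E → Ω → ℝ} (hd : ∀ ω, ContDiff ℝ 1 fun x => f x ω)
    (hm : ∀ x, Measurable (f x)) (x v : E) :
    Measurable fun ω => fderiv ℝ (fun y => f y ω) x v := by
  refine measurable_of_tendsto_metrizable (f := fun (k : ℕ) ω =>
    (k : ℝ) • (f (x + (k : ℝ)⁻¹ • v) ω - f x ω)) (fun k => ?_) ?_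
  · exact ((hm _).sub (hm _)).const_smul (k : ℝ)
  · rw [tendsto_pi_nhds]
    intro ω
    refine (((hd ω).differentiable one_ne_zero) x).hasFDerivAt.lim v ?_
    simpa using tendsto_natCast_atTop_atTop (R := ℝ)

lemma measurable_uncurry_fderiv_field {𝒢 : MeasurableSpace Ω} {n : ℕ}
    {f : (Fin n → ℝ) → Ω → ℝ} (hd : ∀ ω, ContDiff ℝ 1 fun x => f x ω)
    (hm : ∀ x, Measurable (f x)) (v : Fin n → ℝ) :
    Measurable (Function.uncurry fun x ω => fderiv ℝ (fun y => f y ω) x v) :=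
  measurable_uncurry_of_continuous_of_measurable
    (fun ω => ((hd ω).continuous_fderiv one_ne_zero).clm_apply continuous_const)
    (fun x => measurable_fderiv_field hd hm x v)

/-- Justifies Fubini: the L¹ norm of k(I - y) U in (ω, y) is ‖k‖₁ ‖U‖₁, and F is bounded. -/
lemma integrable_prod_translate {mΩ : MeasurableSpace Ω} {P : Measure Ω} [SFinite P] {n : ℕ}
    {I : Ω → Fin n → ℝ} (hI : Measurable I) {U : Ω → ℝ} (hU : Integrable U P)
    {k : (Fin n → ℝ) → ℝ} (hk : Continuous k) (hkc : HasCompactSupport k)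
    {F : (Fin n → ℝ) → Ω → ℝ} (hF : Measurable (Function.uncurry F)) {N : ℝ}
    (hN : ∀ x ω, |F x ω| ≤ N) :
    Integrable (fun p : Ω × (Fin n → ℝ) => F p.2 p.1 * (k (I p.1 - p.2) * U p.1))
      (P.prod volume) := by
  have hki : Integrable k volume := hk.integrable_of_hasCompactSupport hkc
  have h1 : Integrable (fun p : Ω × (Fin n → ℝ) => k (I p.1 - p.2) * U p.1)
      (P.prod volume) := by
    have hmeas : AEStronglyMeasurable (fun p : Ω × (Fin n → ℝ) => k (I p.1 - p.2) * U p.1)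
        (P.prod volume) :=
      (hk.measurable.comp ((hI.comp measurable_fst).sub measurable_snd)).aestronglyMeasurable.mul
        hU.1.comp_fst
    rw [integrable_prod_iff hmeas]
    refine ⟨.of_forall fun ω => (hki.comp_sub_left (I ω)).mul_const (U ω), ?_⟩
    have : (fun ω => ∫ y, ‖k (I ω - y) * U ω‖) = fun ω => (∫ y, ‖k y‖) * ‖U ω‖ := by
      ext ω
      simp_rw [norm_mul]
      rw [integral_mul_const, integral_sub_left_eq_self (fun y => ‖k y‖) volume (I ω)]
    rw [this]
    exact hU.norm.const_mul _
  refine h1.bdd_mul (c := N) ?_ (.of_forall fun p => hN p.2 p.1)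
  exact (hF.comp measurable_swap).aestronglyMeasurable

/-- Integration by parts, where the sign cancels against the one from differentiating k(x - y) in y.
It moves the derivative from the mollifier to the field. -/
lemma integral_mul_fderiv_translate {n : ℕ} {g : (Fin n → ℝ) → ℝ} (hg : ContDiff ℝ 1 g)
    {k : (Fin n → ℝ) → ℝ} (hk : ContDiff ℝ 1 k) (hkc : HasCompactSupport k) (x v : Fin n → ℝ) :
    ∫ y, g y * fderiv ℝ k (x - y) v = ∫ y, fderiv ℝ g y v * k (x - y) := by
  have hkc' : HasCompactSupport fun y => k (x - y) :=
    hkc.comp_homeomorph (Homeomorph.subLeft x)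
  have hkx : ContDiff ℝ 1 fun y => k (x - y) := hk.comp (contDiff_const.sub contDiff_id)
  have hfd : ∀ y, fderiv ℝ (fun y => k (x - y)) y v = -(fderiv ℝ k (x - y) v) := by
    intro y
    have h1 := (hk.differentiable one_ne_zero (x - y)).hasFDerivAt.comp y
      ((hasFDerivAt_id y).const_sub x)
    have h2 : fderiv ℝ (fun y => k (x - y)) y = _ := h1.fderiv
    rw [h2]
    simp
  have hcont : Continuous fun y => fderiv ℝ k (x - y) v :=
    ((hk.continuous_fderiv one_ne_zero).comp (continuous_const.sub continuous_id)).clm_apply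
      continuous_const
  have hgc : Continuous fun y => fderiv ℝ g y v :=
    (hg.continuous_fderiv one_ne_zero).clm_apply continuous_const
  have hcs : HasCompactSupport fun y => fderiv ℝ k (x - y) v :=
    (hkc.fderiv_apply (𝕜 := ℝ) v).comp_homeomorph (Homeomorph.subLeft x)
  have h := integral_mul_fderiv_eq_neg_fderiv_mul_of_integrable (μ := volume) (f := g)
    (g := fun y => k (x - y)) (v := v)
    ((hgc.mul hkx.continuous).integrable_of_hasCompactSupport hkc'.mul_left)
    (by
      simp_rw [hfd]
      exact ((hg.continuous.mul hcont.neg).integrable_of_hasCompactSupport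
        (HasCompactSupport.mul_left (f := g) (hcs.comp_left (g := fun z : ℝ => -z) neg_zero))))
    ((hg.continuous.mul hkx.continuous).integrable_of_hasCompactSupport hkc'.mul_left)
    (fun y _ => (hg.differentiable one_ne_zero) y)
    (fun y _ => (hkx.differentiable one_ne_zero) y)
  simp_rw [hfd, mul_neg, integral_neg, neg_inj] at h
  exact h

lemma abs_integral_mul_translate_le {n : ℕ} {g k : (Fin n → ℝ) → ℝ} {N : ℝ}
    (hg : ∀ y, |g y| ≤ N) (hk0 : ∀ y, 0 ≤ k y) (hki : Integrable k) (hk1 : ∫ y, k y = 1)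
    (x : Fin n → ℝ) : |∫ y, g y * k (x - y)| ≤ N := by
  have h1 : Integrable (fun y => N * k (x - y)) := (hki.comp_sub_left x).const_mul N
  have h := norm_integral_le_of_norm_le (f := fun y => g y * k (x - y)) h1 (.of_forall fun y => by
    rw [norm_mul, Real.norm_eq_abs, Real.norm_eq_abs, abs_of_nonneg (hk0 _)]
    exact mul_le_mul_of_nonneg_right (hg y) (hk0 _))
  rwa [integral_const_mul, integral_sub_left_eq_self k volume x, hk1, mul_one] at h

lemma tendsto_integral_mul_translate {n : ℕ} {g : (Fin n → ℝ) → ℝ} (hg : Continuous g)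
    {φ : ℕ → ContDiffBump (0 : Fin n → ℝ)}
    (hφ : Filter.Tendsto (fun i => (φ i).rOut) Filter.atTop (nhds 0)) (x : Fin n → ℝ) :
    Filter.Tendsto (fun i => ∫ y, g y * (φ i).normed volume (x - y)) Filter.atTop (nhds (g x)) := by
  refine (ContDiffBump.convolution_tendsto_right_of_continuous (μ := volume) hφ hg x).congr
    fun i => ?_
  rw [convolution_def, ← integral_sub_left_eq_self _ volume x]
  refine integral_congr_ae (.of_forall fun y => ?_)
  simp [mul_comm]

lemma tendsto_integral_mul_of_bounded {mΩ : MeasurableSpace Ω} {P : Measure Ω} {U : Ω → ℝ}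
    (hU : Integrable U P) {F : ℕ → Ω → ℝ} {G : Ω → ℝ} {N : ℝ}
    (hF : ∀ i, AEStronglyMeasurable (F i) P) (hN : ∀ i ω, |F i ω| ≤ N)
    (hlim : ∀ ω, Filter.Tendsto (fun i => F i ω) Filter.atTop (nhds (G ω))) :
    Filter.Tendsto (fun i => ∫ ω, F i ω * U ω ∂P) Filter.atTop (nhds (∫ ω, G ω * U ω ∂P)) := by
  refine tendsto_integral_of_dominated_convergence (fun ω => N * ‖U ω‖)
    (fun i => (hF i).mul hU.1) (hU.norm.const_mul N) (fun i => .of_forall fun ω => ?_)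
    (.of_forall fun ω => (hlim ω).mul_const _)
  rw [norm_mul]
  exact mul_le_mul_of_nonneg_right (hN i ω) (norm_nonneg _)

/-- Mollification in the space variable reduces an integration by parts formula for random fields
to the case of products of a random variable and a test function. -/
theorem integral_field_eq_of_test {Ω : Type*} (𝒢 : MeasurableSpace Ω) {mΩ : MeasurableSpace Ω}
    (h𝒢 : 𝒢 ≤ mΩ) {P : Measure Ω} [IsFiniteMeasure P] {n : ℕ} {I : Ω → Fin n → ℝ}
    (hI : Measurable I) {U : Ω → ℝ} (hU : Integrable U P) {V : Fin n → Ω → ℝ}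
    (hV : ∀ i, Integrable (V i) P)
    (htest : ∀ ψ : (Fin n → ℝ) → ℝ, ContDiff ℝ ((⊤ : ℕ∞) : WithTop ℕ∞) ψ → HasCompactSupport ψ →
      ∀ Z : Ω → ℝ, Measurable[𝒢] Z → (∃ C, ∀ ω, |Z ω| ≤ C) →
      ∫ ω, Z ω * (ψ (I ω) * U ω - ∑ i, fderiv ℝ ψ (I ω) (Pi.single i 1) * V i ω) ∂P = 0)
    {f : (Fin n → ℝ) → Ω → ℝ} (hd : ∀ ω, ContDiff ℝ 1 fun x => f x ω)
    (hm : ∀ x, Measurable[𝒢] (f x)) {N : ℝ} (hN : ∀ x ω, |f x ω| ≤ N)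
    (hN' : ∀ i x ω, |fderiv ℝ (fun y => f y ω) x (Pi.single i 1)| ≤ N) :
    ∫ ω, (f (I ω) ω * U ω -
      ∑ i, fderiv ℝ (fun y => f y ω) (I ω) (Pi.single i 1) * V i ω) ∂P = 0 := by
  have hm' : ∀ x, Measurable (f x) := fun x => (hm x).mono h𝒢 le_rfl
  have hfu : Measurable (Function.uncurry f) :=
    measurable_uncurry_of_continuous_of_measurable (fun ω => (hd ω).continuous) hm'
  have hfd := fun v => measurable_uncurry_fderiv_field hd hm' v
  -- The formula for the field convolved with ψ: for each fixed y the hypothesis applies to the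
  -- translate ψ(· - y) and to Z = f(y, ·); then one integrates over y and exchanges the integrals.
  have step : ∀ ψ : (Fin n → ℝ) → ℝ, ContDiff ℝ ((⊤ : ℕ∞) : WithTop ℕ∞) ψ → HasCompactSupport ψ →
      (∫ ω, (∫ y, f y ω * ψ (I ω - y)) * U ω ∂P) -
      ∑ i, ∫ ω, (∫ y, fderiv ℝ (fun y => f y ω) y (Pi.single i 1) * ψ (I ω - y)) * V i ω ∂P
        = 0 := by
    intro ψ hψ hψc
    have hψ1 : ContDiff ℝ 1 ψ := hψ.of_le (by exact_mod_cast le_top)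
    have hi0 := integrable_prod_translate hI hU hψ.continuous hψc hfu hN
    have hi1 : ∀ i, Integrable (fun p : Ω × (Fin n → ℝ) =>
        f p.2 p.1 * (fderiv ℝ ψ (I p.1 - p.2) (Pi.single i 1) * V i p.1)) (P.prod volume) :=
      fun i => integrable_prod_translate (k := fun x => fderiv ℝ ψ x (Pi.single i 1)) hI (hV i)
        ((hψ1.continuous_fderiv one_ne_zero).clm_apply continuous_const)
        (hψc.fderiv_apply (𝕜 := ℝ) _) hfu hN
    have hsum : Integrable (fun p : Ω × (Fin n → ℝ) => ∑ i,
        f p.2 p.1 * (fderiv ℝ ψ (I p.1 - p.2) (Pi.single i 1) * V i p.1)) (P.prod volume) :=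
      integrable_finsetSum _ fun i _ => hi1 i
    have hzero : ∫ y, ∫ ω, (f y ω * (ψ (I ω - y) * U ω) -
        ∑ i, f y ω * (fderiv ℝ ψ (I ω - y) (Pi.single i 1) * V i ω)) ∂P = 0 := by
      refine integral_eq_zero_of_ae (.of_forall fun y => ?_)
      have h := htest (fun x => ψ (x - y)) (hψ.comp (contDiff_id.sub contDiff_const))
        (hψc.comp_homeomorph (Homeomorph.subRight y)) (f y) (hm y) ⟨N, hN y⟩
      have hsub : ∀ x, fderiv ℝ (fun x => ψ (x - y)) x = fderiv ℝ ψ (x - y) := fun x => by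
        simpa [sub_eq_add_neg] using fderiv_comp_add_right (𝕜 := ℝ) (f := ψ) (x := x) (-y)
      simp_rw [hsub] at h
      simp_rw [mul_sub, Finset.mul_sum] at h
      exact h
    have hsw := integral_integral_swap (f := fun ω y => f y ω * (ψ (I ω - y) * U ω) -
        ∑ i, f y ω * (fderiv ℝ ψ (I ω - y) (Pi.single i 1) * V i ω)) (hi0.sub hsum)
    rw [← hsw] at hzero
    have e0 : ∫ ω, (∫ y, f y ω * ψ (I ω - y)) * U ω ∂P =
        ∫ p, f p.2 p.1 * (ψ (I p.1 - p.2) * U p.1) ∂(P.prod volume) := by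
      rw [integral_prod _ hi0]
      refine integral_congr_ae (.of_forall fun ω => ?_)
      dsimp only
      rw [← integral_mul_const]
      simp_rw [mul_assoc]
    have e1 : ∀ i, ∫ ω, (∫ y, fderiv ℝ (fun y => f y ω) y (Pi.single i 1) * ψ (I ω - y)) *
        V i ω ∂P = ∫ p, f p.2 p.1 * (fderiv ℝ ψ (I p.1 - p.2) (Pi.single i 1) * V i p.1)
          ∂(P.prod volume) := by
      intro i
      rw [integral_prod _ (hi1 i)]
      refine integral_congr_ae (.of_forall fun ω => ?_)
      dsimp only
      rw [← integral_mul_fderiv_translate (hd ω) hψ1 hψc, ← integral_mul_const]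
      simp_rw [mul_assoc]
    rw [e0]
    simp_rw [e1]
    rw [← integral_finsetSum _ fun i _ => hi1 i, ← integral_sub hi0 hsum]
    exact (integral_prod _ (hi0.sub hsum)).trans hzero
  -- Normalised bumps with supports shrinking to 0. The convolutions keep the bound N, so dominated
  -- convergence applies.
  let φ : ℕ → ContDiffBump (0 : Fin n → ℝ) := fun k =>
    ⟨1 / (k + 1 : ℝ) / 2, 1 / (k + 1 : ℝ), by positivity, half_lt_self (by positivity)⟩
  have hφ : Filter.Tendsto (fun k => (φ k).rOut) Filter.atTop (nhds 0) :=
    tendsto_one_div_add_atTop_nhds_zero_nat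
  have hmeas : ∀ {F : (Fin n → ℝ) → Ω → ℝ} (_ : Measurable (Function.uncurry F)) (k : ℕ),
      AEStronglyMeasurable (fun ω => ∫ y, F y ω * (φ k).normed volume (I ω - y)) P := by
    intro F hF k
    have h1 : Measurable fun p : Ω × (Fin n → ℝ) =>
        F p.2 p.1 * (φ k).normed volume (I p.1 - p.2) :=
      (hF.comp measurable_swap).mul ((φ k).continuous_normed.measurable.comp
        ((hI.comp measurable_fst).sub measurable_snd))
    exact (h1.stronglyMeasurable.integral_prod_right (ν := volume)).aestronglyMeasurable
  have hbd : ∀ {F : (Fin n → ℝ) → Ω → ℝ} (_ : ∀ x ω, |F x ω| ≤ N) (k : ℕ) (ω : Ω),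
      |∫ y, F y ω * (φ k).normed volume (I ω - y)| ≤ N := fun hF k ω =>
    abs_integral_mul_translate_le (fun y => hF y ω) (φ k).nonneg_normed (φ k).integrable_normed
      (φ k).integral_normed _
  have l0 := tendsto_integral_mul_of_bounded (P := P) hU (hmeas hfu) (hbd hN)
    (fun ω => tendsto_integral_mul_translate (hd ω).continuous hφ (I ω))
  have l1 := fun i => tendsto_integral_mul_of_bounded (P := P) (hV i)
    (hmeas (hfd (Pi.single i 1))) (hbd (hN' i))
    (fun ω => tendsto_integral_mul_translate (((hd ω).continuous_fderiv one_ne_zero).clm_apply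
      continuous_const) hφ (I ω))
  have hlim := l0.sub (tendsto_finsetSum Finset.univ fun i _ => l1 i)
  have hconst : ∀ k, _ = (0 : ℝ) := fun k => step ((φ k).normed volume)
    (φ k).contDiff_normed (φ k).hasCompactSupport_normed
  have h0 := tendsto_nhds_unique hlim (tendsto_const_nhds.congr fun k => (hconst k).symm)
  have hI' : Measurable fun ω => (I ω, ω) := hI.prodMk measurable_id
  have j0 : Integrable (fun ω => f (I ω) ω * U ω) P :=
    hU.bdd_mul (c := N) (hfu.comp hI').aestronglyMeasurable (.of_forall fun ω => hN _ ω)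
  have j1 : ∀ i, Integrable
      (fun ω => fderiv ℝ (fun y => f y ω) (I ω) (Pi.single i 1) * V i ω) P := fun i =>
    (hV i).bdd_mul (c := N) ((hfd (Pi.single i 1)).comp hI').aestronglyMeasurable
      (.of_forall fun ω => hN' i _ ω)
  rw [integral_sub j0 (integrable_finsetSum _ fun i _ => j1 i),
    integral_finsetSum _ fun i _ => j1 i]
  exact h0

end Mollification

/-! ### The duality formula on trigonometric test variables -/

section Elementary

variable {Ω : Type*} {d m : ℕ}

/-- Uniform bounds on f and its first partial derivatives make F and DF square integrable, so that
the duality formula may be applied to them; it is recorded here in scalar form. -/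
lemma integral_smooth_field_eq {𝔽 : MeasurableSpace Ω} [mΩ : MeasurableSpace Ω] (h𝔽 : 𝔽 ≤ mΩ)
    {P : Measure Ω} [IsProbabilityMeasure P] {W : ℝ → Ω → Vec m} {a b : ℝ}
    {X : Ω → PathSpace d m a b} (hX : MemLp X 2 P) {Y : Lp (Vec d) 2 P}
    (hXY : ∀ p ∈ malliavinElementary d 𝔽 P W a b,
      ∫ ω, inner ℝ (p.1 ω) (Y ω) ∂P = ∫ ω, inner ℝ (p.2 ω) (X ω) ∂P)
    {n : ℕ} (hn : 1 ≤ n) {φ : Fin n → Lp (Vec m) 2 (leb a b)} {I : Fin n → Lp ℝ 2 P}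
    (hI : ∀ i, IsWienerIntegral P W a b (φ i) (I i))
    {f : (Fin n → ℝ) → Ω → ℝ} (hf : IsSmoothField (𝔽 ⊔ nullSigma P) f) {C : ℝ}
    (hC : ∀ x ω, |f x ω| ≤ C)
    (hC' : ∀ i x ω, |fderiv ℝ (fun y => f y ω) x (Pi.single i 1)| ≤ C) (h : Vec d) :
    ∫ ω, (f (fun j => I j ω) ω * inner ℝ h (Y ω) -
      ∑ i, fderiv ℝ (fun x => f x ω) (fun j => I j ω) (Pi.single i 1) *
        inner ℝ (outerPath a b h (φ i)) (X ω)) ∂P = 0 := by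
  have hle : 𝔽 ⊔ nullSigma P ≤ mΩ := sup_le h𝔽 (nullSigma_le P)
  have hIm : AEMeasurable (fun ω => ((fun j => I j ω : Fin n → ℝ), ω)) P :=
    (aemeasurable_pi_lambda _ fun j => (Lp.aestronglyMeasurable (I j)).aemeasurable).prodMk
      aemeasurable_id
  have hd : ∀ ω, ContDiff ℝ 1 fun x => f x ω := fun ω =>
    (hf.smooth ω).of_le (by exact_mod_cast le_top)
  have hm : ∀ x, Measurable (f x) := fun x => (hf.measurable x).mono hle le_rfl
  have h0 : AEStronglyMeasurable (fun ω => f (fun j => I j ω) ω) P :=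
    ((measurable_uncurry_of_continuous_of_measurable (u := f) (fun ω => (hd ω).continuous)
      hm).comp_aemeasurable hIm).aestronglyMeasurable
  have h1 : ∀ i, AEStronglyMeasurable
      (fun ω => fderiv ℝ (fun x => f x ω) (fun j => I j ω) (Pi.single i 1)) P := fun i =>
    ((measurable_uncurry_fderiv_field hd hm (Pi.single i 1)).comp_aemeasurable
      hIm).aestronglyMeasurable
  have m0 : MemLp (fun ω => f (fun j => I j ω) ω • h) 2 P :=
    MemLp.of_bound (h0.smul_const h) (C * ‖h‖) (.of_forall fun ω => by
      rw [norm_smul]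
      exact mul_le_mul_of_nonneg_right (hC _ ω) (norm_nonneg _))
  have m1 : MemLp (fun ω => ∑ i, fderiv ℝ (fun x => f x ω) (fun j => I j ω) (Pi.single i 1) •
      outerPath a b h (φ i)) 2 P :=
    memLp_finsetSum _ fun i _ => MemLp.of_bound ((h1 i).smul_const _)
      (C * ‖outerPath a b h (φ i)‖) (.of_forall fun ω => by
        rw [norm_smul]
        exact mul_le_mul_of_nonneg_right (hC' i _ ω) (norm_nonneg _))
  have key := hXY (m0.toLp _, m1.toLp _) ⟨n, hn, φ, I, hI, f, hf, h, m0.coeFn_toLp, by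
    filter_upwards [m1.coeFn_toLp] with ω e
    rw [eq_sum_smul_outerPath_iff, e]⟩
  have e0 : ∫ ω, inner ℝ ((m0.toLp _ : Lp (Vec d) 2 P) ω) (Y ω) ∂P =
      ∫ ω, f (fun j => I j ω) ω * inner ℝ h (Y ω) ∂P := by
    refine integral_congr_ae ?_
    filter_upwards [m0.coeFn_toLp] with ω e
    rw [e, real_inner_smul_left]
  have e1 : ∫ ω, inner ℝ ((m1.toLp _ : Lp (PathSpace d m a b) 2 P) ω) (X ω) ∂P =
      ∫ ω, ∑ i, fderiv ℝ (fun x => f x ω) (fun j => I j ω) (Pi.single i 1) *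
        inner ℝ (outerPath a b h (φ i)) (X ω) ∂P := by
    refine integral_congr_ae ?_
    filter_upwards [m1.coeFn_toLp] with ω e
    rw [e, sum_inner]
    simp_rw [real_inner_smul_left]
  have i0 : Integrable (fun ω => f (fun j => I j ω) ω * inner ℝ h (Y ω)) P :=
    (((Lp.memLp Y).const_inner h).integrable one_le_two).bdd_mul h0 (.of_forall fun ω => hC _ ω)
  have i1 : Integrable (fun ω => ∑ i, fderiv ℝ (fun x => f x ω) (fun j => I j ω) (Pi.single i 1) *
      inner ℝ (outerPath a b h (φ i)) (X ω)) P :=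
    integrable_finsetSum _ fun i _ =>
      ((hX.const_inner _).integrable one_le_two).bdd_mul (h1 i) (.of_forall fun ω => hC' i _ ω)
  rw [integral_sub i0 i1, sub_eq_zero, ← e0, ← e1]
  exact key

lemma HasBoundedDerivs.exists_bound {n : ℕ} {g : (Fin n → ℝ) → ℝ} (hg : HasBoundedDerivs g) :
    ∃ C, (∀ x, |g x| ≤ C) ∧ ∀ (i : Fin n) x, |fderiv ℝ g x (Pi.single i 1)| ≤ C := by
  obtain ⟨C₀, h0⟩ := hg.2 0
  obtain ⟨C₁, h1⟩ := hg.2 1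
  refine ⟨max C₀ C₁, fun x => ?_, fun i x => ?_⟩
  · have := h0 x
    rw [norm_iteratedFDeriv_zero] at this
    exact this.trans (le_max_left _ _)
  · have h2 := h1 x
    rw [norm_iteratedFDeriv_one] at h2
    have h3 := (fderiv ℝ g x).le_opNorm (Pi.single i 1)
    rw [Pi.norm_single, norm_one, mul_one] at h3
    exact (h3.trans h2).trans (le_max_right _ _)

lemma isSmoothField_indicator {𝒢 : MeasurableSpace Ω} {n : ℕ} {g : (Fin n → ℝ) → ℝ}
    (hg : HasBoundedDerivs g) {A : Set Ω} (hA : MeasurableSet A) :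
    IsSmoothField 𝒢 fun x ω => A.indicator (fun _ => (1 : ℝ)) ω * g x where
  smooth _ := (hg.const_mul _).1
  bounded _ := (hg.const_mul _).2
  measurable _ := (measurable_const.indicator hA).mul_const _

lemma fderiv_mul_tail {n : ℕ} {τ : ℝ → ℝ} (hτ : HasBoundedDerivs τ) {ψ : (Fin n → ℝ) → ℝ}
    (hψ : HasBoundedDerivs ψ) (x : Fin (n + 1) → ℝ) (i : Fin n) :
    fderiv ℝ (fun x : Fin (n + 1) → ℝ => τ (x 0) * ψ (Fin.tail x)) x (Pi.single i.succ 1) =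
      τ (x 0) * fderiv ℝ ψ (Fin.tail x) (Pi.single i 1) := by
  have h1 : HasFDerivAt (fun x : Fin (n + 1) → ℝ => τ (x 0)) _ x :=
    ((hτ.1.differentiable (by simp)) (x 0)).hasFDerivAt.comp x
      (ContinuousLinearMap.proj (R := ℝ) (φ := fun _ : Fin (n + 1) => ℝ) 0).hasFDerivAt
  have h2 : HasFDerivAt (fun x : Fin (n + 1) → ℝ => ψ (Fin.tail x)) _ x :=
    ((hψ.1.differentiable (by simp)) (Fin.tail x)).hasFDerivAt.comp x
      (ContinuousLinearMap.pi fun i : Fin n =>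
        ContinuousLinearMap.proj (R := ℝ) (φ := fun _ : Fin (n + 1) => ℝ) i.succ).hasFDerivAt
  have hmul : fderiv ℝ (fun x : Fin (n + 1) → ℝ => τ (x 0) * ψ (Fin.tail x)) x = _ :=
    (h1.mul h2).fderiv
  rw [hmul]
  have h3 : (ContinuousLinearMap.pi fun i : Fin n =>
      ContinuousLinearMap.proj (R := ℝ) (φ := fun _ : Fin (n + 1) => ℝ) i.succ)
      (Pi.single i.succ 1) = Pi.single i 1 := by
    ext j
    simp [Pi.single_apply]
  simp [h3]

/-- The duality formula for products of an indicator function, a trigonometric function of an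
integral which does not contribute to the derivative, and a smooth function. -/
lemma setIntegral_mul_trig_eq_zero {𝔽 : MeasurableSpace Ω} [mΩ : MeasurableSpace Ω] (h𝔽 : 𝔽 ≤ mΩ)
    {P : Measure Ω} [IsProbabilityMeasure P] {W : ℝ → Ω → Vec m} {a b : ℝ}
    {X : Ω → PathSpace d m a b} (hX : MemLp X 2 P) {Y : Lp (Vec d) 2 P}
    (hXY : ∀ p ∈ malliavinElementary d 𝔽 P W a b,
      ∫ ω, inner ℝ (p.1 ω) (Y ω) ∂P = ∫ ω, inner ℝ (p.2 ω) (X ω) ∂P)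
    {n : ℕ} {φ : Fin n → Lp (Vec m) 2 (leb a b)} {I : Fin n → Lp ℝ 2 P}
    (hI : ∀ i, IsWienerIntegral P W a b (φ i) (I i)) {χ : Lp (Vec m) 2 (leb a b)} {L : Lp ℝ 2 P}
    (hL : IsWienerIntegral P W a b χ L) (h : Vec d)
    (hχ : ∀ ω, inner ℝ (outerPath a b h χ) (X ω) = 0) {τ : ℝ → ℝ} (hτ : HasBoundedDerivs τ)
    {ψ : (Fin n → ℝ) → ℝ} (hψ : HasBoundedDerivs ψ) {A : Set Ω}
    (hA : MeasurableSet[𝔽 ⊔ nullSigma P] A) :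
    ∫ ω in A, τ (L ω) * (ψ (fun j => I j ω) * inner ℝ h (Y ω) -
      ∑ i, fderiv ℝ ψ (fun j => I j ω) (Pi.single i 1) *
        inner ℝ (outerPath a b h (φ i)) (X ω)) ∂P = 0 := by
  have hAm : MeasurableSet A := (sup_le h𝔽 (nullSigma_le P) : _ ≤ mΩ) _ hA
  set g : (Fin (n + 1) → ℝ) → ℝ := fun x => τ (x 0) * ψ (Fin.tail x) with hgdef
  have hg : HasBoundedDerivs g :=
    (hτ.comp (ContinuousLinearMap.proj (R := ℝ) (φ := fun _ : Fin (n + 1) => ℝ) 0)).mul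
      (hψ.comp (ContinuousLinearMap.pi fun i : Fin n =>
        ContinuousLinearMap.proj (R := ℝ) (φ := fun _ : Fin (n + 1) => ℝ) i.succ))
  have hgd : Differentiable ℝ g := hg.1.differentiable (by simp)
  obtain ⟨C, hC, hC'⟩ := hg.exists_bound
  have hfd : ∀ ω x, fderiv ℝ (fun x => A.indicator (fun _ => (1 : ℝ)) ω * g x) x =
      A.indicator (fun _ => (1 : ℝ)) ω • fderiv ℝ g x := fun ω x =>
    fderiv_const_mul (hgd x) _
  have hind : ∀ ω, |A.indicator (fun _ => (1 : ℝ)) ω| ≤ 1 := fun ω => by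
    by_cases hω : ω ∈ A <;> simp [hω]
  -- L is prepended as coordinate 0, so the field is 1_A(ω) τ(x₀) ψ(x₁, …, xₙ). This leaves n = 0
  -- admissible.
  have key := integral_smooth_field_eq h𝔽 hX hXY (n := n + 1) (by omega)
    (φ := Fin.cons χ φ) (I := Fin.cons L I) (fun i => by
      refine Fin.cases ?_ (fun i => ?_) i
      · simpa using hL
      · simpa using hI i)
    (isSmoothField_indicator hg hA) (C := C)
    (fun x ω => by
      rw [abs_mul]
      exact (mul_le_of_le_one_left (abs_nonneg _) (hind ω)).trans (hC x))
    (fun i x ω => by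
      rw [hfd, smul_apply, smul_eq_mul, abs_mul]
      exact (mul_le_of_le_one_left (abs_nonneg _) (hind ω)).trans (hC' i x)) h
  rw [← key, ← integral_indicator hAm]
  refine integral_congr_ae (.of_forall fun ω => ?_)
  have ht : Fin.tail (fun j => (Fin.cons L I : Fin (n + 1) → Lp ℝ 2 P) j ω) =
      fun j => I j ω := by
    ext j; simp [Fin.tail]
  simp only [hfd, smul_apply, smul_eq_mul]
  rw [Fin.sum_univ_succ]
  -- The derivative in the direction of L drops out because its integrand is orthogonal to X.
  simp only [Fin.cons_zero, Fin.cons_succ, hχ ω, mul_zero, zero_add]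
  simp only [hgdef, fderiv_mul_tail hτ hψ, ht, Fin.cons_zero]
  by_cases hω : ω ∈ A
  · simp only [indicator_of_mem hω, one_mul, mul_sub, Finset.mul_sum]
    ring_nf
  · simp [indicator_of_notMem hω]

end Elementary

/-! ### Linear combinations of increments as Wiener integrals -/

section IncrementFamily

variable {Ω : Type*} [mΩ : MeasurableSpace Ω] {m : ℕ} {P : Measure Ω} {W : ℝ → Ω → Vec m}
  {S T : ℝ}

/-- The coordinates of the increments of `W` over a family of intervals. -/
def incrFamily {Ω : Type*} {m : ℕ} (W : ℝ → Ω → Vec m) (𝒦 : Set (ℝ × ℝ)) : 𝒦 × Fin m → Ω → ℝ :=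
  fun k ω => W k.1.1.2 ω k.2 - W k.1.1.1 ω k.2

/-- The submodule M carries along a linear property of the integrand: vanishing on [s,t] in the
converse direction, no condition in the uniqueness proof. -/
lemma IsBrownianOn.exists_wiener_of_mem_span (hW : IsBrownianOn P W S T) {𝒦 : Set (ℝ × ℝ)}
    (h𝒦 : ∀ k ∈ 𝒦, S ≤ k.1 ∧ k.1 ≤ k.2 ∧ k.2 ≤ T) (M : Submodule ℝ (Lp (Vec m) 2 (leb S T)))
    (hM : ∀ k ∈ 𝒦, ∀ (j : Fin m) (χ : Lp (Vec m) 2 (leb S T)),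
      χ =ᵐ[leb S T] (Ioc k.1 k.2).indicator (fun _ => EuclideanSpace.single j (1 : ℝ)) → χ ∈ M)
    {L : Ω → ℝ} (hL : L ∈ Submodule.span ℝ (range (incrFamily W 𝒦))) :
    ∃ χ ∈ M, ∃ L' : Lp ℝ 2 P, IsWienerIntegral P W S T χ L' ∧ L' =ᵐ[P] L := by
  induction hL using Submodule.span_induction with
  | mem L hL =>
    obtain ⟨⟨⟨k, hk⟩, j⟩, rfl⟩ := hL
    obtain ⟨h1, h2, h3⟩ := h𝒦 k hk
    obtain ⟨p, hp⟩ := hW.exists_isStep S T h1 h2 h3 j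
    exact ⟨p.1, hM k hk j p.1 hp.1, p.2, hp.mem_wienerGraph h1 h2 h3, hp.2⟩
  | zero => exact ⟨0, M.zero_mem, 0, (wienerGraph P W S T).zero_mem, Lp.coeFn_zero _ _ _⟩
  | add L₁ L₂ _ _ h₁ h₂ =>
    obtain ⟨χ₁, hχ₁, L₁', hw₁, he₁⟩ := h₁
    obtain ⟨χ₂, hχ₂, L₂', hw₂, he₂⟩ := h₂
    exact ⟨χ₁ + χ₂, M.add_mem hχ₁ hχ₂, L₁' + L₂', (wienerGraph P W S T).add_mem hw₁ hw₂,
      (Lp.coeFn_add _ _).trans (he₁.add he₂)⟩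
  | smul c L _ h =>
    obtain ⟨χ, hχ, L', hw, he⟩ := h
    exact ⟨c • χ, M.smul_mem c hχ, c • L', (wienerGraph P W S T).smul_mem c hw,
      (Lp.coeFn_smul _ _).trans (he.const_smul c)⟩

lemma measurable_of_incrFamily {Ω : Type*} {m : ℕ} {W : ℝ → Ω → Vec m} {𝒦 : Set (ℝ × ℝ)}
    {u v : ℝ} (hk : (u, v) ∈ 𝒦) :
    Measurable[⨆ k, (inferInstance : MeasurableSpace ℝ).comap (incrFamily W 𝒦 k)]
      fun ω => W v ω - W u ω := by
  have h : ∀ j : Fin m, Measurable[⨆ k, (inferInstance : MeasurableSpace ℝ).comap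
      (incrFamily W 𝒦 k)] (incrFamily W 𝒦 (⟨(u, v), hk⟩, j)) := fun j =>
    Measurable.mono (comap_measurable _) (le_iSup (fun k =>
      (inferInstance : MeasurableSpace ℝ).comap (incrFamily W 𝒦 k)) _) le_rfl
  exact Measurable.comp (WithLp.measurable_toLp 2 _) (@measurable_pi_lambda _ _ _
    (⨆ k, (inferInstance : MeasurableSpace ℝ).comap (incrFamily W 𝒦 k)) _ _ h)

lemma IsBrownianOn.measurable_incrFamily (hW : IsBrownianOn P W S T) {𝒦 : Set (ℝ × ℝ)}
    (h𝒦 : ∀ k ∈ 𝒦, S ≤ k.1 ∧ k.1 ≤ k.2 ∧ k.2 ≤ T) (k : 𝒦 × Fin m) :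
    Measurable (incrFamily W 𝒦 k) := by
  obtain ⟨h1, h2, h3⟩ := h𝒦 k.1 k.1.2
  have hv := hW.measurable k.1.1.2 ⟨h1.trans h2, h3⟩
  have hu := hW.measurable k.1.1.1 ⟨h1, h2.trans h3⟩
  have hc : Measurable fun x : Vec m => x k.2 := by fun_prop
  exact (hc.comp hv).sub (hc.comp hu)

/-- The intervals `(S, r]` with `r ≤ s` and `(t, r]` with `r ≤ T`. -/
def sideIntervals (S s t T : ℝ) : Set (ℝ × ℝ) :=
  {k | (k.1 = S ∧ k.2 ∈ Icc S s) ∨ (k.1 = t ∧ k.2 ∈ Icc t T)}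

lemma sideSigma_le_incrFamily {Ω : Type*} {m : ℕ} (W : ℝ → Ω → Vec m) (S s t T : ℝ) :
    sideSigma W S s t T ≤ ⨆ k, (inferInstance : MeasurableSpace ℝ).comap
      (incrFamily W (sideIntervals S s t T) k) :=
  sup_le (incrSigma_le fun _ hr => measurable_of_incrFamily (Or.inl ⟨rfl, hr⟩))
    (incrSigma_le fun _ hr => measurable_of_incrFamily (Or.inr ⟨rfl, hr⟩))

lemma sideIntervals_bounds {s t : ℝ} (hs : S ≤ s) (hst : s ≤ t) (ht : t ≤ T) :
    ∀ k ∈ sideIntervals S s t T, S ≤ k.1 ∧ k.1 ≤ k.2 ∧ k.2 ≤ T := by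
  rintro ⟨u, v⟩ (⟨h1, h2⟩ | ⟨h1, h2⟩) <;> simp only at h1 h2 <;> subst h1
  · exact ⟨le_rfl, h2.1, h2.2.trans (hst.trans ht)⟩
  · exact ⟨hs.trans hst, h2.1, h2.2⟩

/-- A side interval meets [s,t] at most in the null point s. This is the reason why outer increments
contribute nothing to the derivative on [s,t]. -/
lemma restrictL_sideIntervals {s t : ℝ} (hs : S ≤ s) (ht : t ≤ T) :
    ∀ k ∈ sideIntervals S s t T, ∀ (j : Fin m) (χ : Lp (Vec m) 2 (leb S T)),
      χ =ᵐ[leb S T] (Ioc k.1 k.2).indicator (fun _ => EuclideanSpace.single j (1 : ℝ)) →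
        χ ∈ LinearMap.ker (restrictL (Vec m) hs ht).toLinearMap := by
  intro k hk j χ hχ
  rw [LinearMap.mem_ker]
  refine Lp.ext ((restrictL_coe hs ht χ).trans (Filter.EventuallyEq.trans ?_
    (Lp.coeFn_zero _ _ _).symm))
  have hne : ∀ᵐ r ∂(leb s t), r ≠ s := by
    rw [ae_iff]; simp
  filter_upwards [ae_mono (leb_mono hs ht) hχ, hne, ae_restrict_mem measurableSet_Icc]
    with r h1 h2 h3
  rw [h1, indicator_of_notMem, Pi.zero_apply]
  rintro ⟨h4, h5⟩
  rcases hk with ⟨-, h6⟩ | ⟨h6, -⟩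
  · exact h2 (le_antisymm (h5.trans h6.2) h3.1)
  · rw [h6] at h4
    exact absurd h3.2 (not_le.2 h4)

end IncrementFamily

/-! ### From duality over [S,T] to duality over [s,t] -/

section Converse

variable {Ω : Type*} {d m : ℕ}

/-- The event that a random field and its partial derivatives are bounded by `N`. -/
def boundedSet {Ω : Type*} {n : ℕ} (f : (Fin n → ℝ) → Ω → ℝ) (N : ℕ) : Set Ω :=
  {ω | ∀ x, |f x ω| ≤ N ∧ ∀ i : Fin n, |fderiv ℝ (fun y => f y ω) x (Pi.single i 1)| ≤ N}

lemma measurableSet_boundedSet {𝒢 : MeasurableSpace Ω} {n : ℕ} {f : (Fin n → ℝ) → Ω → ℝ}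
    (hd : ∀ ω, ContDiff ℝ 1 fun x => f x ω) (hm : ∀ x, Measurable (f x)) (N : ℕ) :
    MeasurableSet (boundedSet f N) := by
  -- By continuity in x the bounds need checking only on a countable dense set.
  have : boundedSet f N = ⋂ k : ℕ, {ω | |f (TopologicalSpace.denseSeq (Fin n → ℝ) k) ω| ≤ N ∧
      ∀ i : Fin n, |fderiv ℝ (fun y => f y ω) (TopologicalSpace.denseSeq (Fin n → ℝ) k)
        (Pi.single i 1)| ≤ N} := by
    ext ω
    simp only [mem_iInter]
    refine ⟨fun h k => h _, fun h x => ?_⟩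
    have hcl : IsClosed {x | |f x ω| ≤ N ∧
        ∀ i : Fin n, |fderiv ℝ (fun y => f y ω) x (Pi.single i 1)| ≤ N} := by
      simp only [ofPred_and, ofPred_forall]
      refine (isClosed_le (hd ω).continuous.abs continuous_const).inter
        (isClosed_iInter fun i => isClosed_le ?_ continuous_const)
      exact (((hd ω).continuous_fderiv one_ne_zero).clm_apply continuous_const).abs
    have hsub : range (TopologicalSpace.denseSeq (Fin n → ℝ)) ⊆ {x | |f x ω| ≤ N ∧
        ∀ i : Fin n, |fderiv ℝ (fun y => f y ω) x (Pi.single i 1)| ≤ N} := by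
      rintro _ ⟨k, rfl⟩
      exact h k
    exact hcl.closure_subset_iff.2 hsub (TopologicalSpace.denseRange_denseSeq _ x)
  rw [this]
  refine MeasurableSet.iInter fun k => ?_
  simp only [ofPred_and, ofPred_forall]
  refine (measurableSet_le (hm _).abs measurable_const).inter (MeasurableSet.iInter fun i =>
    measurableSet_le (measurable_fderiv_field hd hm _ _).abs measurable_const)

lemma monotone_boundedSet {n : ℕ} (f : (Fin n → ℝ) → Ω → ℝ) : Monotone (boundedSet f) := by
  intro N M hNM ω hω x
  have h : (N : ℝ) ≤ M := by exact_mod_cast hNM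
  exact ⟨(hω x).1.trans h, fun i => ((hω x).2 i).trans h⟩

lemma IsSmoothField.iUnion_boundedSet {𝒢 : MeasurableSpace Ω} {n : ℕ}
    {f : (Fin n → ℝ) → Ω → ℝ} (hf : IsSmoothField 𝒢 f) : ⋃ N, boundedSet f N = univ := by
  refine eq_univ_of_forall fun ω => mem_iUnion.2 ?_
  obtain ⟨C, h1, h2⟩ := HasBoundedDerivs.exists_bound (g := fun x => f x ω)
    ⟨hf.smooth ω, hf.bounded ω⟩
  obtain ⟨N, hN⟩ := exists_nat_ge C
  exact ⟨N, fun x => ⟨(h1 x).trans hN, fun i => (h2 i x).trans hN⟩⟩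

/-- If `Y` satisfies the duality formula for the elementary random variables over `[S, T]`, then
it satisfies it for the elementary random variables over `[s, t]`. -/
theorem IsBrownianOn.duality_of_duality_indicator {𝔽 : MeasurableSpace Ω}
    [mΩ : MeasurableSpace Ω] (h𝔽 : 𝔽 ≤ mΩ) {P : Measure Ω} [IsProbabilityMeasure P]
    {W : ℝ → Ω → Vec m} {S s t T : ℝ} (hW : IsBrownianOn P W S T) (hs : S ≤ s) (hst : s ≤ t)
    (ht : t ≤ T) {X : Ω → PathSpace d m S T} (hX : MemLp (fun ω => indicatorTime s t (X ω)) 2 P)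
    {Y : Lp (Vec d) 2 P}
    (hXY : ∀ p ∈ malliavinElementary d 𝔽 P W S T,
      ∫ ω, inner ℝ (p.1 ω) (Y ω) ∂P = ∫ ω, inner ℝ (p.2 ω) (indicatorTime s t (X ω)) ∂P)
    {p : Lp (Vec d) 2 P × Lp (PathSpace d m s t) 2 P}
    (hp : p ∈ malliavinElementary d (outerSigma 𝔽 P W S s t T) P W s t) :
    ∫ ω, inner ℝ (p.1 ω) (Y ω) ∂P = ∫ ω, inner ℝ (p.2 ω) (restrictTime hs ht (X ω)) ∂P := by
  obtain ⟨n, hn, φ, I, hI, f, hf, h, h1, h2⟩ := hp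
  have hXr : MemLp (fun ω => restrictTime hs ht (X ω)) 2 P := by
    have := (restrictL (Mat d m) hs ht).comp_memLp' hX
    refine this.ae_eq (.of_forall fun ω => ?_)
    exact restrictL_indicatorTime hs ht (X ω)
  have h𝒢 : outerSigma 𝔽 P W S s t T ⊔ nullSigma P ≤ mΩ :=
    sup_le (outerSigma_le P h𝔽 hs hst ht hW.measurable) (nullSigma_le P)
  obtain ⟨J, hJ, hIJ⟩ := aestronglyMeasurable_pi (ℋ := mΩ) fun i => Lp.aestronglyMeasurable (I i)
  set U : Ω → ℝ := fun ω => inner ℝ h (Y ω) with hUdef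
  set V : Fin n → Ω → ℝ := fun i ω => inner ℝ (outerPath s t h (φ i)) (restrictTime hs ht (X ω))
    with hVdef
  have hU : Integrable U P := ((Lp.memLp Y).const_inner h).integrable one_le_two
  have hV : ∀ i, Integrable (V i) P := fun i => (hXr.const_inner _).integrable one_le_two
  have hVeq : ∀ i ω, inner ℝ (outerPath S T h (extendL _ hs ht (φ i)))
      (indicatorTime s t (X ω)) = V i ω := by
    intro i ω
    rw [← extendL_restrictL hs ht, inner_extendL, restrictL_outerPath, restrictL_extendL]
    rfl
  -- The case of product fields Z ψ. The bracket integrates to zero against 1_A cos L and 1_A sin L,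
  -- hence over every event of the enlarged sigma-algebra, hence against every bounded Z measurable
  -- with respect to it.
  have htest : ∀ ψ : (Fin n → ℝ) → ℝ, ContDiff ℝ ((⊤ : ℕ∞) : WithTop ℕ∞) ψ →
      HasCompactSupport ψ → ∀ Z : Ω → ℝ,
      Measurable[outerSigma 𝔽 P W S s t T ⊔ nullSigma P] Z → (∃ C, ∀ ω, |Z ω| ≤ C) →
      ∫ ω, Z ω * (ψ (J ω) * U ω - ∑ i, fderiv ℝ ψ (J ω) (Pi.single i 1) * V i ω) ∂P = 0 := by
    rintro ψ hψ hψc Z hZ ⟨C, hC⟩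
    have hψb := hasBoundedDerivs_of_hasCompactSupport hψ hψc
    obtain ⟨K, hK, hK'⟩ := hψb.exists_bound
    have hG : Integrable
        (fun ω => ψ (J ω) * U ω - ∑ i, fderiv ℝ ψ (J ω) (Pi.single i 1) * V i ω) P := by
      refine Integrable.sub (hU.bdd_mul (c := K) ?_ (.of_forall fun ω => hK _))
        (integrable_finsetSum _ fun i _ => (hV i).bdd_mul (c := K) ?_
          (.of_forall fun ω => hK' i _))
      · exact (hψ.continuous.measurable.comp hJ).aestronglyMeasurable
      · have : Continuous fun x => fderiv ℝ ψ x (Pi.single i 1) :=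
          (hψ.continuous_fderiv (by simp)).clm_apply continuous_const
        exact (this.measurable.comp hJ).aestronglyMeasurable
    refine integral_mul_eq_zero_of_forall_setIntegral _ h𝒢 hG (fun B hB => ?_) hZ hC
    have htrig : ∀ τ : ℝ → ℝ, HasBoundedDerivs τ → ∀ A, MeasurableSet[𝔽 ⊔ nullSigma P] A →
        ∀ L ∈ Submodule.span ℝ (range (incrFamily W (sideIntervals S s t T))),
        ∫ ω in A, τ (L ω) * (ψ (J ω) * U ω -
          ∑ i, fderiv ℝ ψ (J ω) (Pi.single i 1) * V i ω) ∂P = 0 := by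
      intro τ hτ A hA L hL
      obtain ⟨χ, hχ, L', hw, he⟩ := hW.exists_wiener_of_mem_span
        (sideIntervals_bounds hs hst ht) _ (restrictL_sideIntervals hs ht) hL
      have hχ0 : restrictL (Vec m) hs ht χ = 0 := hχ
      have key := setIntegral_mul_trig_eq_zero h𝔽 hX hXY
        (φ := fun i => extendL _ hs ht (φ i)) (I := I)
        (fun i => extendL_mem_wienerGraph hs ht (hI i)) hw h (fun ω => by
          rw [← extendL_restrictL hs ht, inner_extendL, restrictL_outerPath, hχ0, map_zero,
            inner_zero_left]) hτ hψb hA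
      rw [← key]
      refine integral_congr_ae (ae_restrict_of_ae ?_)
      filter_upwards [he, hIJ] with ω e1 e2
      simp only [hVeq]
      rw [e1, e2]
    refine setIntegral_eq_zero_of_trig (𝔽 ⊔ nullSigma P) (sup_le h𝔽 (nullSigma_le P)) hG
      (J := incrFamily W (sideIntervals S s t T))
      (hW.measurable_incrFamily (sideIntervals_bounds hs hst ht))
      (htrig _ hasBoundedDerivs_cos) (htrig _ hasBoundedDerivs_sin) ?_
    refine (?_ : outerSigma 𝔽 P W S s t T ⊔ nullSigma P ≤ _) _ hB
    rw [outerSigma_eq]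
    exact sup_le (sup_le le_sup_left ((sideSigma_le_incrFamily W S s t T).trans le_sup_right))
      (le_sup_of_le_left le_sup_right)
  have hd : ∀ ω, ContDiff ℝ 1 fun x => f x ω := fun ω =>
    (hf.smooth ω).of_le (by exact_mod_cast le_top)
  set Φ : Ω → ℝ := fun ω => f (J ω) ω * U ω -
    ∑ i, fderiv ℝ (fun y => f y ω) (J ω) (Pi.single i 1) * V i ω with hΦdef
  have hΦ : (fun ω => inner ℝ (p.1 ω) (Y ω) - inner ℝ (p.2 ω) (restrictTime hs ht (X ω)))
      =ᵐ[P] Φ := by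
    filter_upwards [h1, h2, hIJ] with ω e1 e2 e3
    rw [eq_sum_smul_outerPath_iff] at e2
    rw [e1, e2, e3, sum_inner, real_inner_smul_left]
    simp_rw [real_inner_smul_left]
    rfl
  have i1 : Integrable (fun ω => inner ℝ (p.1 ω) (Y ω)) P := L2.integrable_inner p.1 Y
  have i2 : Integrable (fun ω => inner ℝ (p.2 ω) (restrictTime hs ht (X ω))) P := by
    refine (L2.integrable_inner p.2 (hXr.toLp _)).congr ?_
    filter_upwards [hXr.coeFn_toLp] with ω e
    rw [e]
  -- Integrability comes from F and DF being in L²; the single terms of the sum over i need not be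
  -- integrable.
  have hΦi : Integrable Φ P := (i1.sub i2).congr hΦ
  have hBm := fun N => measurableSet_boundedSet hd hf.measurable N
  -- The bounds on f depend on ω. Multiplying by the indicator of this event makes them uniform and
  -- keeps the field measurable; the events increase to Ω.
  have hN : ∀ N, ∫ ω in boundedSet f N, Φ ω ∂P = 0 := by
    intro N
    classical
    have hcase : ∀ ω, (fun x => (boundedSet f N).indicator (f x) ω) =
        if ω ∈ boundedSet f N then (fun x => f x ω) else fun _ => 0 := by
      intro ω
      split_ifs with hω
      · ext x; rw [indicator_of_mem hω]
      · ext x; rw [indicator_of_notMem hω]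
    have key := integral_field_eq_of_test _ h𝒢 hJ hU hV htest
      (f := fun x ω => (boundedSet f N).indicator (f x) ω) (N := N)
      (fun ω => by
        rw [hcase]
        split_ifs
        · exact hd ω
        · exact contDiff_const)
      (fun x => (hf.measurable x).indicator (hBm N))
      (fun x ω => by
        by_cases hω : ω ∈ boundedSet f N
        · rw [indicator_of_mem hω]
          exact (hω x).1
        · rw [indicator_of_notMem hω]
          simp)
      (fun i x ω => by
        rw [hcase]
        split_ifs with hω
        · exact (hω x).2 i
        · simp)
    rw [← key, ← integral_indicator (h𝒢 _ (hBm N))]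
    refine integral_congr_ae (.of_forall fun ω => ?_)
    dsimp only
    rw [hcase]
    by_cases hω : ω ∈ boundedSet f N
    · rw [indicator_of_mem hω, indicator_of_mem hω, if_pos hω]
    · rw [indicator_of_notMem hω, indicator_of_notMem hω, if_neg hω]
      simp
  have hlim := tendsto_setIntegral_of_monotone (μ := P) (f := Φ) (fun N => h𝒢 _ (hBm N))
    (monotone_boundedSet f) hΦi.integrableOn
  rw [hf.iUnion_boundedSet, setIntegral_univ] at hlim
  have h0 : ∫ ω, Φ ω ∂P = 0 :=
    tendsto_nhds_unique hlim (tendsto_const_nhds.congr fun N => (hN N).symm)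
  rw [← sub_eq_zero, ← integral_sub i1 i2, integral_congr_ae hΦ, h0]

end Converse

/-! ### Uniqueness of the integral -/

section Uniqueness

variable {Ω : Type*} {d m : ℕ}

/-- The elementary random variables determine the elements of `L²(P|_{𝔽_T}; ℝ^d)`. -/
theorem IsBrownianOn.eq_of_forall_elementary {𝔽 : MeasurableSpace Ω}
    [mΩ : MeasurableSpace Ω] (h𝔽 : 𝔽 ≤ mΩ) {P : Measure Ω} [IsProbabilityMeasure P]
    {W : ℝ → Ω → Vec m} {S T : ℝ} (hST : S ≤ T) (hW : IsBrownianOn P W S T)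
    {Y₁ Y₂ : Lp (Vec d) 2 P} (hm₁ : AEStronglyMeasurable[fullSigma 𝔽 P W S T] Y₁ P)
    (hm₂ : AEStronglyMeasurable[fullSigma 𝔽 P W S T] Y₂ P)
    (hY : ∀ p ∈ malliavinElementary d 𝔽 P W S T,
      ∫ ω, inner ℝ (p.1 ω) (Y₁ ω) ∂P = ∫ ω, inner ℝ (p.1 ω) (Y₂ ω) ∂P) : Y₁ =ᵐ[P] Y₂ := by
  set D : Lp (Vec d) 2 P := Y₁ - Y₂ with hD
  have hDm : AEStronglyMeasurable[fullSigma 𝔽 P W S T] D P :=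
    (hm₁.sub hm₂).congr (Lp.coeFn_sub _ _).symm
  -- The difference D satisfies the duality formula with integrand 0, so the trigonometric formula
  -- above applies to it.
  have hdual : ∀ p ∈ malliavinElementary d 𝔽 P W S T,
      ∫ ω, inner ℝ (p.1 ω) (D ω) ∂P =
        ∫ ω, inner ℝ (p.2 ω) ((fun _ => 0 : Ω → PathSpace d m S T) ω) ∂P := by
    intro p hp
    have := hY p hp
    rw [← L2.inner_def, ← L2.inner_def] at this
    rw [← L2.inner_def, hD, inner_sub_right, this]
    simp
  -- With s = t = T the side intervals include all (S, r] with r in [S,T], so they generate every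
  -- increment.
  have h𝒦 : ∀ k ∈ sideIntervals S T T T, S ≤ k.1 ∧ k.1 ≤ k.2 ∧ k.2 ≤ T :=
    sideIntervals_bounds hST le_rfl le_rfl
  have hle := fullSigma_le P h𝔽 hW.measurable
  have key : ∀ h : Vec d, ∀ᵐ ω ∂P, inner ℝ h (D ω) = (0 : ℝ) := by
    intro h
    have hG : Integrable (fun ω => inner ℝ h (D ω)) P :=
      ((Lp.memLp D).const_inner h).integrable one_le_two
    have htrig : ∀ τ : ℝ → ℝ, HasBoundedDerivs τ → ∀ A, MeasurableSet[𝔽 ⊔ nullSigma P] A →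
        ∀ L ∈ Submodule.span ℝ (range (incrFamily W (sideIntervals S T T T))),
        ∫ ω in A, τ (L ω) * inner ℝ h (D ω) ∂P = 0 := by
      intro τ hτ A hA L hL
      obtain ⟨χ, -, L', hw, he⟩ := hW.exists_wiener_of_mem_span h𝒦 ⊤ (fun _ _ _ _ _ => trivial) hL
      -- With n = 0 and ψ = 1 only τ(L) remains and there are no derivative terms.
      have := setIntegral_mul_trig_eq_zero h𝔽 (MemLp.zero' (p := 2)) hdual (n := 0)
        (φ := Fin.elim0) (I := Fin.elim0) (fun i => i.elim0) hw h (fun ω => by simp) hτ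
        (ψ := fun _ => 1)
        (hasBoundedDerivs_of_hasCompactSupport contDiff_const (.of_compactSpace _)) hA
      rw [← this]
      refine integral_congr_ae (ae_restrict_of_ae ?_)
      filter_upwards [he] with ω e
      simp [e]
    have hzero : ∀ B, MeasurableSet[fullSigma 𝔽 P W S T] B →
        ∫ ω in B, inner ℝ h (D ω) ∂P = 0 := by
      intro B hB
      refine setIntegral_eq_zero_of_trig (𝔽 ⊔ nullSigma P) (sup_le h𝔽 (nullSigma_le P)) hG
        (J := incrFamily W (sideIntervals S T T T)) (hW.measurable_incrFamily h𝒦)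
        (htrig _ hasBoundedDerivs_cos) (htrig _ hasBoundedDerivs_sin) ?_
      refine (?_ : fullSigma 𝔽 P W S T ≤ _) _ hB
      exact sup_le (sup_le (le_sup_of_le_left le_sup_left)
        ((le_sup_left.trans (sideSigma_le_incrFamily W S T T T)).trans le_sup_right))
        (le_sup_of_le_left le_sup_right)
    refine ae_eq_of_forall_setIntegral_eq_of_sigmaFinite' (g := fun _ => (0 : ℝ)) hle
      (fun s _ _ => hG.integrableOn) (fun s _ _ => (integrable_zero Ω ℝ P).integrableOn)
      (fun s hs _ => ?_) ?_ ?_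
    · rw [hzero s hs]; simp
    · obtain ⟨g, hg, hDg⟩ := hDm
      refine ⟨fun ω => inner ℝ h (g ω), ?_, ?_⟩
      · exact (continuous_const.inner continuous_id).comp_stronglyMeasurable hg
      · filter_upwards [hDg] with ω e
        rw [e]
    · exact stronglyMeasurable_const.aestronglyMeasurable
  have hall : ∀ᵐ ω ∂P, ∀ i : Fin d, inner ℝ (EuclideanSpace.single i (1 : ℝ)) (D ω) = (0 : ℝ) :=
    ae_all_iff.2 fun i => key _
  filter_upwards [hall, Lp.coeFn_sub Y₁ Y₂] with ω e1 e2
  have : D ω = 0 := by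
    ext i
    have := e1 i
    rw [EuclideanSpace.inner_single_left] at this
    simpa using this
  rw [hD, e2, Pi.sub_apply, sub_eq_zero] at this
  exact this

end Uniqueness

/-! ### Equality of the two notions of integral -/

section Equivalence

variable {Ω : Type*} {d m : ℕ}

/-- The Skorohod integrals of `X` over `[s, t]` with respect to the enlarged sigma-algebra are
the Skorohod integrals of `1_{[s,t]} X` over `[S, T]`. -/
theorem IsBrownianOn.isSkorohodIntegral_restrict_iff {𝔽 : MeasurableSpace Ω}
    [mΩ : MeasurableSpace Ω] (h𝔽 : 𝔽 ≤ mΩ) {P : Measure Ω} [IsProbabilityMeasure P]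
    {W : ℝ → Ω → Vec m} {S s t T : ℝ} (hW : IsBrownianOn P W S T) (hs : S ≤ s) (hst : s ≤ t)
    (ht : t ≤ T) (X : Ω → PathSpace d m S T) (Y : Lp (Vec d) 2 P) :
    IsSkorohodIntegral (outerSigma 𝔽 P W S s t T) P W s t (fun ω => restrictTime hs ht (X ω)) Y ↔
      IsSkorohodIntegral 𝔽 P W S T (fun ω => indicatorTime s t (X ω)) Y := by
  have hfull := fullSigma_outerSigma 𝔽 P W hs hst ht
  constructor
  · rintro ⟨⟨hXm, hX, -⟩, hYm, h⟩
    rw [hfull] at hXm hYm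
    -- The integrability bound is not carried over; it is recovered from Y itself.
    refine isSkorohodIntegral_of_elementary ?_ ?_ hYm fun p hp => ?_
    · refine ((extendL (Mat d m) hs ht).continuous.comp_aestronglyMeasurable hXm).congr
        (.of_forall fun ω => ?_)
      exact extendL_restrictL hs ht (X ω)
    · refine ((extendL (Mat d m) hs ht).comp_memLp' hX).ae_eq (.of_forall fun ω => ?_)
      exact extendL_restrictL hs ht (X ω)
    · rw [h _ (restrict_mem_malliavinElementary hW hs hst ht hp)]
      refine integral_congr_ae ?_
      filter_upwards [(restrictL (Mat d m) hs ht).coeFn_compLp p.2] with ω e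
      rw [e, ← extendL_restrictL hs ht, inner_extendL]
      rfl
  · rintro ⟨⟨hXm, hX, -⟩, hYm, h⟩
    refine isSkorohodIntegral_of_elementary ?_ ?_ (by rwa [hfull]) fun p hp =>
      hW.duality_of_duality_indicator h𝔽 hs hst ht hX h hp
    · rw [hfull]
      refine ((restrictL (Mat d m) hs ht).continuous.comp_aestronglyMeasurable hXm).congr
        (.of_forall fun ω => ?_)
      exact restrictL_indicatorTime hs ht (X ω)
    · refine ((restrictL (Mat d m) hs ht).comp_memLp' hX).ae_eq (.of_forall fun ω => ?_)
      exact restrictL_indicatorTime hs ht (X ω)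

end Equivalence

end ExtendedSkorohod

/-! ### The proposition -/

theorem propositionA6 {Ω : Type*} (𝔽 : MeasurableSpace Ω) [mΩ : MeasurableSpace Ω]
    (P : Measure Ω) [IsProbabilityMeasure P] {d m : ℕ} (hd : 1 ≤ d) (hm : 1 ≤ m)
    {S T : ℝ} (hST : S < T) (W : ℝ → Ω → ExtendedSkorohod.Vec m)
    (hW : ExtendedSkorohod.IsBrownianOn P W S T)
    (h𝔽 : 𝔽 ≤ mΩ)
    (hindep : Indep 𝔽 (ExtendedSkorohod.incrSigma W S T) P)
    (X : Ω → ExtendedSkorohod.PathSpace d m S T) (hX : AEStronglyMeasurable X P)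
    {s t : ℝ} (hs : S ≤ s) (hst : s < t) (ht : t ≤ T) :
    (ExtendedSkorohod.IsSkorohodIntegrable (ExtendedSkorohod.outerSigma 𝔽 P W S s t T) P W s t
        (fun ω => ExtendedSkorohod.restrictTime hs ht (X ω)) ↔
      ExtendedSkorohod.IsSkorohodIntegrable 𝔽 P W S T
        (fun ω => ExtendedSkorohod.indicatorTime s t (X ω))) ∧
    (ExtendedSkorohod.IsSkorohodIntegrable 𝔽 P W S T
        (fun ω => ExtendedSkorohod.indicatorTime s t (X ω)) →
      (∃ Y₁ : Lp (ExtendedSkorohod.Vec d) 2 P,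
        ExtendedSkorohod.IsSkorohodIntegral (ExtendedSkorohod.outerSigma 𝔽 P W S s t T) P W s t
          (fun ω => ExtendedSkorohod.restrictTime hs ht (X ω)) Y₁) ∧
      (∃ Y₂ : Lp (ExtendedSkorohod.Vec d) 2 P,
        ExtendedSkorohod.IsSkorohodIntegral 𝔽 P W S T
          (fun ω => ExtendedSkorohod.indicatorTime s t (X ω)) Y₂) ∧
      ∀ Y₁ Y₂ : Lp (ExtendedSkorohod.Vec d) 2 P,
        ExtendedSkorohod.IsSkorohodIntegral (ExtendedSkorohod.outerSigma 𝔽 P W S s t T) P W s t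
          (fun ω => ExtendedSkorohod.restrictTime hs ht (X ω)) Y₁ →
        ExtendedSkorohod.IsSkorohodIntegral 𝔽 P W S T
          (fun ω => ExtendedSkorohod.indicatorTime s t (X ω)) Y₂ →
        Y₁ =ᵐ[P] Y₂) := by
  have hiff := fun Y =>
    hW.isSkorohodIntegral_restrict_iff h𝔽 hs hst.le ht X (Y : Lp (ExtendedSkorohod.Vec d) 2 P)
  have hex₁ := fun h => ExtendedSkorohod.IsSkorohodIntegrable.exists_isSkorohodIntegral (P := P)
    (ExtendedSkorohod.outerSigma_le P h𝔽 hs hst.le ht hW.measurable)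
    (fun r hr => hW.measurable r ⟨hs.trans hr.1, hr.2.trans ht⟩)
    (X := fun ω => ExtendedSkorohod.restrictTime hs ht (X ω)) h
  have hex₂ := fun h => ExtendedSkorohod.IsSkorohodIntegrable.exists_isSkorohodIntegral (P := P)
    h𝔽 hW.measurable (X := fun ω => ExtendedSkorohod.indicatorTime s t (X ω)) h
  -- Integrability on one side yields an integral Y, which is an integral on the other side too, and
  -- having an integral includes being integrable.
  refine ⟨⟨fun h => ?_, fun h => ?_⟩, fun h => ?_⟩
  · obtain ⟨Y, hY⟩ := hex₁ h
    exact ((hiff Y).1 hY).1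
  · obtain ⟨Y, hY⟩ := hex₂ h
    exact ((hiff Y).2 hY).1
  · obtain ⟨Y, hY⟩ := hex₂ h
    refine ⟨⟨Y, (hiff Y).2 hY⟩, ⟨Y, hY⟩, fun Y₁ Y₂ h₁ h₂ => ?_⟩
    have h₁' := (hiff Y₁).1 h₁
    exact hW.eq_of_forall_elementary h𝔽 hST.le h₁'.2.1 h₂.2.1 fun p hp =>
      (h₁'.2.2 p hp).trans (h₂.2.2 p hp).symm
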